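/- Let $d\ge 1$ and let $\mu,\nu$ be Borel probability measures on $\mathbb{R}^d$ with finite first moments, with $\mu$ absolutely continuous with respect to the Lebesgue measure $\mathcal{L}^d$. Let $MT(\mu,\nu)$ be the set of martingale transport plans from $\mu$ to $\nu$, i.e. of the probability measures $\pi$ on $\mathbb{R}^d\times\mathbb{R}^d$ with marginals $\mu$ and $\nu$ whose disintegration $d\pi(x,y)=d\pi_x(y)\,d\mu(x)$ satisfies, for $\mu$-a.e. $x$: $\pi_x$ has a finite first moment and barycenter $\int y\,d\pi_x(y)=x$. Let $\pi\in MT(\mu,\nu)$ be either a maximizer of $\int|x-y|\,d\pi(x,y)$ over $MT(\mu,\nu)$, or a minimizer of it over $MT(\mu,\nu)$, where in the case of minimization it is assumed that $\mu\wedge\nu=0$ (i.e. $\mu$ and $\nu$ are mutually singular). Then for $\mu$-almost every $x\in\mathbb{R}^d$: 1. the Hausdorff dimension of $\operatorname{supp}\pi_x$ is at most $d-1$; and 2. if the affine span of $\operatorname{supp}\pi_x$ has dimension $d$, then $\operatorname{supp}\pi_x=\operatorname{Ext}\big(\operatorname{conv}(\operatorname{supp}\pi_x)\big)$, where $\operatorname{conv}$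 is the convex hull (not closed) and $\operatorname{Ext}$ denotes the set of extreme points. -/

import Mathlib

open MeasureTheory ProbabilityTheory
open scoped ENNReal

/-- The Euclidean space `ℝ^d`; its `volume` is the Lebesgue measure. -/
abbrev Rd (d : ℕ) : Type := EuclideanSpace ℝ (Fin d)

/-- The point `x` is the barycenter of the measure `p`, which has a finite first moment. -/
def HasBarycenter {d : ℕ} (p : Measure (Rd d)) (x : Rd d) : Prop :=
  Integrable (fun y : Rd d => y) p ∧ ∫ y, y ∂p = x

/-- The Markov kernel `κ`, written `x ↦ π_x`, is a disintegration of `π` with respect to `μ`: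
`dπ(x, y) = dπ_x(y) dμ(x)`. -/
def IsDisintegration {d : ℕ} (π : Measure (Rd d × Rd d)) (μ : Measure (Rd d))
    (κ : Kernel (Rd d) (Rd d)) : Prop :=
  IsMarkovKernel κ ∧ π = μ ⊗ₘ κ

/-- The set `MT(μ, ν)` of martingale transport plans: the measures on `ℝ^d × ℝ^d` with marginals
`μ` and `ν` whose disintegration `(π_x)` satisfies: `x` is the barycenter of `π_x` for
`μ`-a.e. `x`. The disintegration is unique up to a `μ`-null set of points `x`. -/
def MT {d : ℕ} (μ ν : Measure (Rd d)) : Set (Measure (Rd d × Rd d)) :=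
  {π | π.fst = μ ∧ π.snd = ν ∧
    ∃ κ : Kernel (Rd d) (Rd d), IsDisintegration π μ κ ∧ ∀ᵐ x ∂μ, HasBarycenter (κ x) x}

/-- The cost `∫ |x - y| dπ(x, y)`. -/
noncomputable def transportCost {d : ℕ} (π : Measure (Rd d × Rd d)) : ℝ :=
  ∫ z, ‖z.1 - z.2‖ ∂π

/-- `π` maximizes the cost over `MT(μ, ν)`. -/
def IsMaximizer {d : ℕ} (μ ν : Measure (Rd d)) (π : Measure (Rd d × Rd d)) : Prop :=
  π ∈ MT μ ν ∧ IsMaxOn transportCost (MT μ ν) π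

/-- `π` minimizes the cost over `MT(μ, ν)`. -/
def IsMinimizer {d : ℕ} (μ ν : Measure (Rd d)) (π : Measure (Rd d × Rd d)) : Prop :=
  π ∈ MT μ ν ∧ IsMinOn transportCost (MT μ ν) π

/-! Put s = 1 for maximization and s = -1 for minimization, and let S_x be the support of π_x. If
S_x spans less than the whole space, the dimension bound is trivial and the second claim is void.
Otherwise conv S_x contains one of countably many basic open sets V, so it suffices to treat, for
each V, the set X of good points x with V ⊆ conv S_x.

On X there are affine functions L_x with s|x' - y| - s|x - y| ≤ L_x(y) - L_{x'}(y) for y in S_x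
(`exists_dual`). They come from optimality: a finite exchange of mass between fibres that preserves
masses and barycentres can be approximated by exchanges between parts of the plan itself, so it
cannot improve the cost (`sum_weights_cost_le_zero_of_pos`). An approximate Farkas lemma then gives
approximate potentials for finitely many fibres, and compactness gives exact ones for all of X.

The map x ↦ L_x is Lipschitz on X, hence differentiable within X at almost all of its points. For y
in S_x the function x' ↦ s|x' - y| + L_{x'}(y) is maximal on X at x, so its derivative vanishes at
density points; thus (y - x)/|y - x| = T(y) with T affine (`ae_exists_affine_direction`). If s = 1,
the kink of the norm excludes y = x; if s = -1, mutual singularity makes {x} a null set of π_x.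

The barycentre condition now forces |T x| ≠ 1 and x ∉ S_x. Since T maps S_x into the unit sphere,
strict convexity of the ball makes T constant on any segment of conv S_x having a point of S_x
inside. Such a segment lies on a line through x, and if nondegenerate it would give |T x| = 1. So
S_x consists of extreme points. These avoid the interior of the hull, and points of a convex body
outside its interior have dimension at most d - 1, because nearest-point projection is 1-Lipschitz.
-/

/-! ### Fermat's theorem at density points -/

open Filter Metric Set in
open scoped Topology Pointwise in
/-- At almost every point of an arbitrary set, Fermat's theorem holds for functions that are
differentiable within this set. -/
theorem ae_fderivWithin_eq_zero_of_isMaxOn {E : Type*} [NormedAddCommGroup E] [NormedSpace ℝ E]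
    [FiniteDimensional ℝ E] [MeasurableSpace E] [BorelSpace E] (μ : Measure E)
    [μ.IsAddHaarMeasure] (s : Set E) :
    ∀ᵐ x ∂μ, x ∈ s → ∀ (f : E → ℝ) (f' : E →L[ℝ] ℝ), HasFDerivWithinAt f f' s x →
      IsMaxOn f s x → f' = 0 := by
  have hdens := Besicovitch.ae_tendsto_measure_inter_div μ s
  filter_upwards [ae_imp_of_ae_restrict hdens] with x hx xs f f' hf hmax
  specialize hx xs
  have key : ∀ z, f' z ≤ 0 := by
    intro z
    have H : ∀ ε : ℝ, 0 < ε → f' z ≤ ε * (‖z‖ + ε) + ‖f'‖ * ε := by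
      intro ε εpos
      -- A density point of `s` can be left in nearly every direction: for small `r` some `x + r •
      -- a` with `a` close to `z` lies in `s`. Maximality there bounds `f' a`, hence `f' z` up to
      -- `ε`.
      have B₁ : ∀ᶠ r in 𝓝[>] (0 : ℝ), (s ∩ ({x} + r • closedBall z ε)).Nonempty :=
        Measure.eventually_nonempty_inter_smul_of_density_one μ s x hx _ measurableSet_closedBall
          (measure_closedBall_pos μ z εpos).ne'
      obtain ⟨ρ, ρpos, hρ⟩ :
          ∃ ρ > 0, ball x ρ ∩ s ⊆ {y : E | ‖f y - f x - f' (y - x)‖ ≤ ε * ‖y - x‖} :=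
        mem_nhdsWithin_iff.1 (hf.isLittleO.def εpos)
      have B₂ : ∀ᶠ r in 𝓝[>] (0 : ℝ), {x} + r • closedBall z ε ⊆ ball x ρ := by
        apply nhdsWithin_le_nhds
        exact eventually_singleton_add_smul_subset isBounded_closedBall (ball_mem_nhds x ρpos)
      obtain ⟨r, ⟨y, ⟨ys, hy⟩⟩, rρ, rpos⟩ :
        ∃ r : ℝ,
          (s ∩ ({x} + r • closedBall z ε)).Nonempty ∧ {x} + r • closedBall z ε ⊆ ball x ρ ∧
            0 < r :=
        (B₁.and (B₂.and self_mem_nhdsWithin)).exists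
      obtain ⟨a, az, ya⟩ : ∃ a, a ∈ closedBall z ε ∧ y = x + r • a := by
        simp only [mem_smul_set, image_add_left, mem_preimage, singleton_add] at hy
        rcases hy with ⟨a, az, ha⟩
        exact ⟨a, az, by simp only [ha, add_neg_cancel_left]⟩
      have norm_a : ‖a‖ ≤ ‖z‖ + ε :=
        calc
          ‖a‖ = ‖z + (a - z)‖ := by simp only [add_sub_cancel]
          _ ≤ ‖z‖ + ‖a - z‖ := norm_add_le _ _
          _ ≤ ‖z‖ + ε := by grw [mem_closedBall_iff_norm.1 az]
      have h1 : ‖f y - f x - f' (y - x)‖ ≤ ε * ‖y - x‖ := hρ ⟨rρ hy, ys⟩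
      have h2 : f y ≤ f x := hmax ys
      have hyx : y - x = r • a := by rw [ya]; abel
      rw [hyx, map_smul, norm_smul, Real.norm_eq_abs, Real.norm_eq_abs, abs_of_pos rpos,
        smul_eq_mul] at h1
      have h3 : r * f' a ≤ r * (ε * ‖a‖) := by
        have := neg_abs_le (f y - f x - r * f' a)
        nlinarith
      have h4 : f' a ≤ ε * ‖a‖ := le_of_mul_le_mul_left h3 rpos
      have h5 : f' (z - a) ≤ ‖f'‖ * ε := by
        refine (le_abs_self _).trans ((f'.le_opNorm _).trans ?_)
        rw [norm_sub_rev]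
        gcongr
        exact mem_closedBall_iff_norm.1 az
      have h6 : f' z = f' a + f' (z - a) := by rw [← map_add]; congr 1; abel
      have : ε * ‖a‖ ≤ ε * (‖z‖ + ε) := by gcongr
      linarith
    have : Tendsto (fun ε : ℝ => ε * (‖z‖ + ε) + ‖f'‖ * ε) (𝓝[>] 0)
        (𝓝 (0 * (‖z‖ + 0) + ‖f'‖ * 0)) :=
      Tendsto.mono_left (Continuous.tendsto (by fun_prop) 0) nhdsWithin_le_nhds
    simp only [zero_mul, mul_zero, add_zero] at this
    exact ge_of_tendsto this (by filter_upwards [self_mem_nhdsWithin] using H)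
  ext z
  have h1 := key z
  have h2 := key (-z)
  rw [map_neg] at h2
  simp only [zero_apply]
  linarith

/-! ### Extreme points from an affine direction field -/

/-- An affine map sending `S` into the unit sphere so that `T y` is the direction from `x` to `y`
for `y ∈ S` maps no point of `S` to a nontrivial convex combination, provided `‖T x‖ ≠ 1`. -/
theorem subset_extremePoints_of_affine_direction {E : Type*} [NormedAddCommGroup E]
    [InnerProductSpace ℝ E] {S : Set E} {x : E} (T : E →ᵃ[ℝ] E) (hx : ‖T x‖ ≠ 1)
    (hT : ∀ y ∈ S, ‖T y‖ = 1 ∧ y - x = ‖y - x‖ • T y) :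
    S ⊆ (convexHull ℝ S).extremePoints ℝ := by
  have hle : convexHull ℝ S ⊆ {z | ‖T z‖ ≤ 1} := by
    refine convexHull_min (fun y hy => (hT y hy).1.le) ?_
    have h : {z | ‖T z‖ ≤ 1} = T ⁻¹' Metric.closedBall (0 : E) 1 := by ext z; simp
    rw [h]
    exact (convex_closedBall (0 : E) 1).affine_preimage T
  -- Points of the hull over a unit vector `u` lie on the line through `x` in direction `u`: in a
  -- convex combination the value 1 of `⟪T z, u⟫` is reached only if all terms with positive weight
  -- reach it.
  have hC : ∀ u : E, ‖u‖ = 1 →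
      ∀ z ∈ convexHull ℝ S, T z = u → z - x = inner ℝ (z - x) u • u := by
    intro u hu z hz hzu
    have hsub : convexHull ℝ S ⊆ {z | inner ℝ (T z) u ≤ 1 ∧
        (inner ℝ (T z) u < 1 ∨ z - x = inner ℝ (z - x) u • u)} := by
      refine convexHull_min (fun y hy => ?_) ?_
      · obtain ⟨h1, h2⟩ := hT y hy
        refine ⟨by simpa [h1, hu] using real_inner_le_norm (T y) u, ?_⟩
        by_cases h : T y = u
        · right
          rw [h2, h, inner_smul_left]
          simp [hu]
        · left
          exact (inner_lt_one_iff_real_of_norm_eq_one h1 hu).2 h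
      · intro z₁ ⟨h1, h1'⟩ z₂ ⟨h2, h2'⟩ a b ha hb hab
        have hTc : T (a • z₁ + b • z₂) = a • T z₁ + b • T z₂ := Convex.combo_affine_apply hab
        have hin : inner ℝ (T (a • z₁ + b • z₂)) u
            = a * inner ℝ (T z₁) u + b * inner ℝ (T z₂) u := by
          rw [hTc, inner_add_left, inner_smul_left, inner_smul_left]; simp
        have hzx : a • z₁ + b • z₂ - x = a • (z₁ - x) + b • (z₂ - x) := by
          have : x = a • x + b • x := by rw [← add_smul, hab, one_smul]
          nth_rewrite 1 [this]
          module
        rcases ha.eq_or_lt with rfl | ha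
        · obtain rfl : b = 1 := by linarith
          simpa using ⟨h2, h2'⟩
        rcases hb.eq_or_lt with rfl | hb
        · obtain rfl : a = 1 := by linarith
          simpa using ⟨h1, h1'⟩
        refine ⟨by rw [hin]; nlinarith, ?_⟩
        rcases h1' with h1' | h1'
        · left; rw [hin]; nlinarith
        rcases h2' with h2' | h2'
        · left; rw [hin]; nlinarith
        right
        rw [hzx, inner_add_left, inner_smul_left, inner_smul_left]
        conv_lhs => rw [h1', h2']
        simp only [conj_trivial]
        module
    rcases (hsub hz).2 with h | h
    · rw [hzu, real_inner_self_eq_norm_sq, hu] at h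
      norm_num at h
    · exact h
  intro y hy
  rw [mem_extremePoints]
  refine ⟨subset_convexHull ℝ S hy, ?_⟩
  rintro z₁ hz₁ z₂ hz₂ ⟨a, b, ha, hb, hab, rfl⟩
  set u := T (a • z₁ + b • z₂) with hu_def
  obtain ⟨hu, -⟩ := hT _ hy
  have hTc : u = a • T z₁ + b • T z₂ := Convex.combo_affine_apply hab
  have hins : 1 = a * inner ℝ (T z₁) u + b * inner ℝ (T z₂) u := by
    have h : inner ℝ u u = (1 : ℝ) := by rw [real_inner_self_eq_norm_sq, hu]; norm_num
    nth_rewrite 1 [hTc] at h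
    rw [inner_add_left, inner_smul_left, inner_smul_left] at h
    simpa using h.symm
  have hle' : ∀ z ∈ convexHull ℝ S, inner ℝ (T z) u ≤ 1 := fun z hz =>
    (real_inner_le_norm _ _).trans (by rw [hu, mul_one]; exact hle hz)
  have heq : ∀ z ∈ convexHull ℝ S, inner ℝ (T z) u = 1 → T z = u := by
    intro z hz h
    have h2 : ‖T z - u‖ ^ 2 ≤ 0 := by
      rw [norm_sub_sq_real, h, hu]
      have := hle hz
      simp only [Set.mem_ofPred_eq] at this
      nlinarith [norm_nonneg (T z)]
    have : ‖T z - u‖ = 0 := by nlinarith [norm_nonneg (T z - u)]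
    exact sub_eq_zero.1 (norm_eq_zero.1 this)
  have h1 := hle' z₁ hz₁
  have h2 := hle' z₂ hz₂
  have hT1 : T z₁ = u := heq z₁ hz₁ (by nlinarith)
  have hT2 : T z₂ = u := heq z₂ hz₂ (by nlinarith)
  have e1 := hC u hu z₁ hz₁ hT1
  have e2 := hC u hu z₂ hz₂ hT2
  set r₁ := inner ℝ (z₁ - x) u
  set r₂ := inner ℝ (z₂ - x) u
  by_cases hr : r₁ = r₂
  · have : z₁ = z₂ := by
      have : z₁ - x = z₂ - x := by rw [e1, e2, hr]
      exact sub_left_injective this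
    subst this
    have : a • z₁ + b • z₁ = z₁ := by rw [← add_smul, hab, one_smul]
    exact ⟨this.symm, this.symm⟩
  -- Two distinct points of that line with the same image make `T.linear` vanish on `u`, so `T` is
  -- constant on the line, which contains `x`; hence `T x = u`.
  · exfalso
    apply hx
    have hl : T.linear (z₁ - z₂) = 0 := by
      have := T.linearMap_vsub z₁ z₂
      rw [vsub_eq_sub, vsub_eq_sub, hT1, hT2, sub_self] at this
      exact this
    have hz : z₁ - z₂ = (r₁ - r₂) • u := by
      rw [sub_smul, ← e1, ← e2]; abel
    rw [hz, map_smul, smul_eq_zero_iff_right (sub_ne_zero.2 hr)] at hl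
    have h3 := T.linearMap_vsub z₁ x
    rw [vsub_eq_sub, vsub_eq_sub, e1, map_smul, hl, smul_zero, hT1] at h3
    rw [← sub_eq_zero.1 h3.symm, hu]

/-! ### Hausdorff dimension bounds -/

theorem dimH_le_finrank_direction {E : Type*} [NormedAddCommGroup E] [NormedSpace ℝ E]
    [FiniteDimensional ℝ E] (S : Set E) :
    dimH S ≤ (Module.finrank ℝ (affineSpan ℝ S).direction : ℝ≥0∞) := by
  rcases S.eq_empty_or_nonempty with rfl | hS
  · simp
  have h := Real.Convex.dimH_eq_finrank_vectorSpan (affineSpan ℝ S).convex (hS.affineSpan ℝ)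
  calc dimH S ≤ dimH (affineSpan ℝ S : Set E) := dimH_mono (subset_affineSpan ℝ S)
    _ = _ := by rw [h]; rfl

theorem dimH_coordinate_hyperplane_le {d : ℕ} (i : Fin d) (r : ℝ) :
    dimH {z : Rd d | z i = r} ≤ ((d - 1 : ℕ) : ℝ≥0∞) := by
  refine (dimH_le_finrank_direction _).trans ?_
  set P : Rd d →ₗ[ℝ] ℝ := (EuclideanSpace.proj i : Rd d →L[ℝ] ℝ).toLinearMap with hP
  have h1 : (affineSpan ℝ {z : Rd d | z i = r}).direction ≤ LinearMap.ker P := by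
    rw [direction_affineSpan, vectorSpan_def, Submodule.span_le]
    rintro _ ⟨a, ha, b, hb, rfl⟩
    simp only [Set.mem_ofPred_eq] at ha hb
    simp [hP, ha, hb]
  have h2 : P ≠ 0 := by
    intro h
    have := congrArg (fun f => f (EuclideanSpace.single i 1)) h
    simp [hP] at this
  have h3 := Submodule.finrank_mono h1
  have h4 : Module.finrank ℝ (LinearMap.ker P) < Module.finrank ℝ (Rd d) :=
    Submodule.finrank_lt (by rwa [Ne, LinearMap.ker_eq_top])
  rw [finrank_euclideanSpace_fin] at h4
  exact_mod_cast h3.trans (by omega)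

/-- Hahn–Banach separates `y` from the open interior, and the inequality extends to `K`, which lies
in the closure of its interior. -/
theorem Convex.exists_normal_of_notMem_interior {E : Type*} [NormedAddCommGroup E]
    [InnerProductSpace ℝ E] [CompleteSpace E] {K : Set E} (hK : Convex ℝ K)
    (hne : (interior K).Nonempty) {y : E} (hy : y ∉ interior K) :
    ∃ n : E, n ≠ 0 ∧ ∀ z ∈ K, inner ℝ n (z - y) ≤ 0 := by
  obtain ⟨f, hf⟩ := geometric_hahn_banach_open_point hK.interior isOpen_interior hy
  refine ⟨(InnerProductSpace.toDual ℝ E).symm f, ?_, fun z hz => ?_⟩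
  · rintro h
    obtain ⟨a, ha⟩ := hne
    have := hf a ha
    rw [(LinearIsometryEquiv.map_eq_zero_iff _).1 h] at this
    simp at this
  · have hz' : z ∈ closure (interior K) := by
      rw [hK.closure_interior_eq_closure_of_nonempty_interior hne]
      exact subset_closure hz
    have hcl : closure (interior K) ⊆ {a | f a ≤ f y} :=
      closure_minimal (fun a ha => (hf a ha).le) (isClosed_le (by fun_prop) (by fun_prop))
    have := hcl hz'
    simp only [Set.mem_ofPred_eq] at this
    simp only [InnerProductSpace.toDual_symm_apply, map_sub]
    linarith

/-- A ray starting inside a large cube hits one of its faces. -/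
theorem exists_ray_mem_face {d : ℕ} {y n : Rd d} (hn : n ≠ 0) {R : ℝ} (hy : ‖y‖ < R) :
    ∃ t : ℝ, 0 ≤ t ∧ ∃ i : Fin d, (y + t • n) i = R ∨ (y + t • n) i = -R := by
  have hex : ∃ i, n i ≠ 0 := by
    by_contra! h
    exact hn (by ext i; simpa using h i)
  obtain ⟨i, hi⟩ := hex
  have hyi : |y i| < R := lt_of_le_of_lt (by simpa using PiLp.norm_apply_le y i) hy
  rw [abs_lt] at hyi
  rcases lt_or_gt_of_ne hi with hi | hi
  · refine ⟨(-R - y i) / n i, div_nonneg_of_nonpos (by linarith) hi.le, i, Or.inr ?_⟩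
    simp [div_mul_cancel₀ _ hi.ne]
  · refine ⟨(R - y i) / n i, div_nonneg (by linarith) hi.le, i, Or.inl ?_⟩
    simp [div_mul_cancel₀ _ hi.ne']

/-- A set of points of a convex body which are not interior has codimension at least one. -/
theorem Convex.dimH_le_of_disjoint_interior {d : ℕ} {K S : Set (Rd d)} (hK : Convex ℝ K)
    (hne : (interior K).Nonempty) (hSK : S ⊆ K) (hS : Disjoint S (interior K)) :
    dimH S ≤ ((d - 1 : ℕ) : ℝ≥0∞) := by
  have key : ∀ R : ℕ, dimH (S ∩ Metric.ball 0 R) ≤ ((d - 1 : ℕ) : ℝ≥0∞) := by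
    intro R
    -- The inequality says that `y` is the point of `K` nearest to `z`. Projection onto `K` is
    -- 1-Lipschitz, so its section `z`, with values on the faces of a cube, does not decrease
    -- distances. Restricting to a ball keeps the starting points inside the cube.
    have hray : ∀ y : (S ∩ Metric.ball 0 R : Set (Rd d)), ∃ z : Rd d,
        (∃ i : Fin d, z i = (R : ℝ) ∨ z i = -(R : ℝ)) ∧
        ∀ w ∈ K, inner ℝ (z - y) (w - y) ≤ 0 := by
      rintro ⟨y, hyS, hyR⟩
      obtain ⟨n, hn, hnK⟩ :=
        hK.exists_normal_of_notMem_interior hne (Set.disjoint_left.1 hS hyS)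
      obtain ⟨t, ht, i, hi⟩ := exists_ray_mem_face hn (by simpa using hyR)
      refine ⟨y + t • n, ⟨i, hi⟩, fun w hw => ?_⟩
      rw [add_sub_cancel_left, inner_smul_left]
      exact mul_nonpos_of_nonneg_of_nonpos (by simpa using ht) (hnK w hw)
    choose z hz hzK using hray
    have hanti : AntilipschitzWith 1 z := by
      refine AntilipschitzWith.of_le_mul_dist fun a b => ?_
      rw [NNReal.coe_one, one_mul, Subtype.dist_eq, dist_eq_norm, dist_eq_norm]
      have h1 := hzK a b (hSK b.2.1)
      have h2 := hzK b a (hSK a.2.1)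
      set u : Rd d := a - b with hu
      have hba : (b : Rd d) - a = -u := by rw [hu]; abel
      rw [hba, inner_neg_right] at h1
      have h4 : z a - z b = u + ((z a - a) - (z b - b)) := by rw [hu]; abel
      have h5 : inner ℝ (z a - z b) u = inner ℝ u u + (inner ℝ (z a - a) u
          - inner ℝ (z b - b) u) := by
        rw [h4, inner_add_left, inner_sub_left (z a - a)]
      have h6 : ‖u‖ * ‖u‖ ≤ ‖z a - z b‖ * ‖u‖ := by
        rw [← real_inner_self_eq_norm_mul_norm]
        have := real_inner_le_norm (z a - z b) u
        linarith
      rcases (norm_nonneg u).eq_or_lt with h | h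
      · rw [← h]; exact norm_nonneg _
      · exact le_of_mul_le_mul_right h6 h
    have himg : z '' Set.univ ⊆ ⋃ i : Fin d, {w : Rd d | w i = (R : ℝ)} ∪ {w | w i = -(R : ℝ)} := by
      rintro _ ⟨y, -, rfl⟩
      obtain ⟨i, hi⟩ := hz y
      exact Set.mem_iUnion.2 ⟨i, hi⟩
    calc dimH (S ∩ Metric.ball 0 R)
        = dimH (Subtype.val '' (Set.univ : Set (S ∩ Metric.ball 0 R : Set (Rd d)))) := by
          rw [Set.image_univ, Subtype.range_coe]
      _ = dimH (Set.univ : Set (S ∩ Metric.ball 0 R : Set (Rd d))) :=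
          isometry_subtype_coe.dimH_image _
      _ ≤ dimH (z '' Set.univ) := hanti.le_dimH_image _
      _ ≤ _ := dimH_mono himg
      _ ≤ ((d - 1 : ℕ) : ℝ≥0∞) := by
          rw [dimH_iUnion]
          refine iSup_le fun i => ?_
          rw [dimH_union]
          exact max_le (dimH_coordinate_hyperplane_le i _) (dimH_coordinate_hyperplane_le i _)
  have hU : S = ⋃ R : ℕ, S ∩ Metric.ball 0 R := by
    rw [← Set.inter_iUnion, Metric.iUnion_ball_nat, Set.inter_univ]
  rw [hU, dimH_iUnion]
  exact iSup_le key

/-! ### Consequences of the barycentre condition -/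

/-- If the direction from the barycenter `x` of `p` is given on the support of `p` by an affine
map, then `x` is not in the support, and its image is not a unit vector. -/
theorem HasBarycenter.notMem_support_of_affine_direction {d : ℕ} {p : Measure (Rd d)}
    [IsProbabilityMeasure p] {x : Rd d} (hp : HasBarycenter p x) (hpx : p {x} = 0)
    (T : Rd d →ᵃ[ℝ] Rd d)
    (hT : ∀ y ∈ p.support, y ≠ x → ‖T y‖ = 1 ∧ y - x = ‖y - x‖ • T y) :
    ‖T x‖ ≠ 1 ∧ x ∉ p.support := by
  have hsupp : ∀ᵐ y ∂p, y ∈ p.support := Measure.support_mem_ae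
  have hne : ∀ᵐ y ∂p, y ≠ x := by
    rw [ae_iff]
    simpa using hpx
  have hTc : Continuous T := T.continuous_of_finiteDimensional
  have hTx : ‖T x‖ ≠ 1 := by
    intro h1
    set A : Rd d →L[ℝ] Rd d := LinearMap.toContinuousLinearMap T.linear with hA
    have hTA : ∀ y, T y = A (y - x) + T x := by
      intro y
      have := T.linearMap_vsub y x
      simp only [vsub_eq_sub] at this
      rw [hA, LinearMap.coe_toContinuousLinearMap', this]; abel
    have hint : Integrable (fun y => y - x) p := hp.1.sub (integrable_const x)
    have h0 : ∫ y, (y - x) ∂p = 0 := by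
      rw [integral_sub hp.1 (integrable_const x), hp.2]; simp
    have hin : ∀ L : Rd d →L[ℝ] ℝ, ∫ y, L (y - x) ∂p = 0 := by
      intro L
      rw [L.integral_comp_comm hint, h0, map_zero]
    -- If `‖T x‖ = 1`, this affine function vanishes at the barycentre, so its mean is 0, and it is
    -- nonnegative on the support off `x`; hence it is 0 a.e. Then `‖y - x‖` agrees a.e. with a
    -- linear function of `y - x`, whose mean is also 0, so `p` would be concentrated at `x`.
    set g : Rd d → ℝ := fun y => 1 - inner ℝ (T x) (T y) with hg
    have hg' : ∀ y, g y = -(((innerSL ℝ (T x)).comp A) (y - x)) := by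
      intro y
      simp only [hg, hTA y, inner_add_right, ContinuousLinearMap.comp_apply, innerSL_apply_apply,
        real_inner_self_eq_norm_sq, h1]
      ring
    have hgint : ∫ y, g y ∂p = 0 := by
      simp_rw [hg']
      rw [integral_neg, hin, neg_zero]
    have hgi : Integrable g p := by
      have : g = fun y => -(((innerSL ℝ (T x)).comp A) (y - x)) := funext hg'
      rw [this]
      exact (ContinuousLinearMap.integrable_comp _ hint).neg
    have hgnn : 0 ≤ᵐ[p] g := by
      filter_upwards [hsupp, hne] with y hy hyx
      have := real_inner_le_norm (T x) (T y)
      rw [h1, (hT y hy hyx).1] at this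
      simp only [hg, Pi.zero_apply]
      linarith
    have hg0 := (integral_eq_zero_iff_of_nonneg_ae hgnn hgi).1 hgint
    have hnorm : ∀ᵐ y ∂p, ‖y - x‖ = innerSL ℝ (T x) (y - x) := by
      filter_upwards [hg0, hsupp, hne] with y hy hys hyx
      have h2 := hT y hys hyx
      have h3 : inner ℝ (T x) (T y) = (1 : ℝ) := by
        simp only [hg, Pi.zero_apply] at hy; linarith
      nth_rewrite 2 [h2.2]
      rw [map_smul, innerSL_apply_apply, h3, smul_eq_mul, mul_one]
    have hn0 : ∫ y, ‖y - x‖ ∂p = 0 := by rw [integral_congr_ae hnorm, hin]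
    have hn1 := (integral_eq_zero_iff_of_nonneg (fun y => norm_nonneg _) hint.norm).1 hn0
    have : ∀ᵐ y ∂p, False := by
      filter_upwards [hn1, hne] with y h1 h2
      exact h2 (sub_eq_zero.1 (norm_eq_zero.1 h1))
    exact this.exists.elim fun _ h => h
  -- As `{x}` is null, a support point `x` is a limit of other support points, where `‖T y‖ = 1`;
  -- this closed condition would pass to `x`.
  refine ⟨hTx, fun hxs => hTx ?_⟩
  have hcl : IsClosed {y : Rd d | ‖T y‖ = 1} := isClosed_eq (by fun_prop) continuous_const
  refine hcl.closure_subset_iff.2 subset_rfl (Metric.mem_closure_iff.2 fun ε hε => ?_)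
  have hpos : 0 < p (Metric.ball x ε) :=
    (Measure.mem_support_iff_forall x).1 hxs _ (Metric.ball_mem_nhds x hε)
  obtain ⟨y, hy, hys, hyx⟩ : ∃ y, y ∈ Metric.ball x ε ∧ y ∈ p.support ∧ y ≠ x := by
    by_contra! h
    refine hpos.ne' (measure_mono_null ?_ (ae_iff.1 (hsupp.and hne)))
    intro y hy
    simp only [Set.mem_ofPred_eq, not_and, not_not]
    exact h y hy
  exact ⟨y, (hT y hys hyx).1, by rw [dist_comm]; exact hy⟩

/-! ### Perturbed weights and an approximate Farkas lemma -/

open scoped Topology in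
/-- Positive coefficients of a spanning family can be adjusted measurably so that the linear
combination does not change under small perturbations of the family. -/
theorem exists_measurable_perturbed_weights {K E : Type*} [Fintype K] [NormedAddCommGroup E]
    [NormedSpace ℝ E] [FiniteDimensional ℝ E] [MeasurableSpace E] [BorelSpace E] (v : K → E)
    (hv : Submodule.span ℝ (Set.range v) = ⊤) (c : K → ℝ) (hc : ∀ k, 0 < c k) {ε : ℝ}
    (hε : 0 < ε) :
    ∃ η > 0, ∃ Λ : (K → E) → K → ℝ, Measurable Λ ∧ ∀ P : K → E, (∀ k, ‖P k - v k‖ ≤ η) →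
      (∀ k, 0 ≤ Λ P k ∧ |Λ P k - c k| ≤ ε) ∧ ∑ k, Λ P k • P k = ∑ k, c k • v k := by
  classical
  have hsurj : Function.Surjective (Fintype.linearCombination ℝ v) := by
    rw [← LinearMap.range_eq_top, Fintype.range_linearCombination, hv]
  obtain ⟨R, hR⟩ := (Fintype.linearCombination ℝ v).exists_rightInverse_of_surjective
    (LinearMap.range_eq_top.2 hsurj)
  set A : (K → E) → (E →L[ℝ] E) := fun P =>
    ∑ k, ((LinearMap.proj k ∘ₗ R : E →ₗ[ℝ] ℝ).toContinuousLinearMap).smulRight (P k) with hA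
  have hAapply : ∀ P x, A P x = ∑ k, R x k • P k := by
    intro P x
    simp [hA]
  have hAv : A v = 1 := by
    ext x
    have := LinearMap.congr_fun hR x
    rw [hAapply]
    simpa [Fintype.linearCombination_apply] using this
  have hAc : Continuous A := by
    refine continuous_finsetSum _ fun k _ => ?_
    exact ((ContinuousLinearMap.smulRightL ℝ E E
      ((LinearMap.proj k ∘ₗ R : E →ₗ[ℝ] ℝ).toContinuousLinearMap)).continuous).comp
        (continuous_apply k)
  set t := ∑ k, c k • v k with ht
  -- With `R` a right inverse of the combination map of `v`, the operator `A P` combines the `P k`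
  -- with weights `R x k`; it is the identity at `P = v`, hence invertible nearby. The correction to
  -- `c` cancels exactly the defect `t - ∑ k, c k • P k`.
  set Λ₀ : (K → E) → K → ℝ := fun P k =>
    c k + R (Ring.inverse (A P) (t - ∑ k, c k • P k)) k with hΛ₀
  set W : Set (K → E) := {P | IsUnit (A P)} with hW
  have hWo : IsOpen W := Units.isOpen.preimage hAc
  have hRc : Continuous R := R.continuous_of_finiteDimensional
  have hcont : ContinuousOn Λ₀ W := by
    intro P hP
    obtain ⟨u, hu⟩ := hP
    have h1 : ContinuousAt (fun P => Ring.inverse (A P)) P := by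
      refine ContinuousAt.comp (g := Ring.inverse) ?_ hAc.continuousAt
      rw [← hu]
      exact NormedRing.inverse_continuousAt u
    have h2 : ContinuousAt (fun P : K → E => t - ∑ k, c k • P k) P :=
      Continuous.continuousAt (by fun_prop)
    have h3 := h1.clm_apply h2
    have h4 := hRc.continuousAt.comp h3
    refine ContinuousAt.continuousWithinAt (continuousAt_pi.2 fun k => ?_)
    exact continuousAt_const.add ((continuous_apply k).continuousAt.comp h4)
  have hvW : v ∈ W := by rw [hW, Set.mem_ofPred_eq, hAv]; exact isUnit_one
  have hΛv : Λ₀ v = c := by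
    ext k
    have : t - ∑ k, c k • v k = 0 := by rw [ht, sub_self]
    simp only [hΛ₀, this, map_zero, Pi.zero_apply, add_zero]
  have hcat : ContinuousAt Λ₀ v := hcont.continuousAt (hWo.mem_nhds hvW)
  have hev : ∀ᶠ P in 𝓝 v, P ∈ W ∧ ∀ k, 0 ≤ Λ₀ P k ∧ |Λ₀ P k - c k| ≤ ε := by
    refine (hWo.eventually_mem hvW).and (Filter.eventually_all.2 fun k => ?_)
    have hk : Filter.Tendsto (fun P => Λ₀ P k) (𝓝 v) (𝓝 (c k)) := by
      have := (continuous_apply k).continuousAt.tendsto.comp hcat.tendsto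
      rwa [hΛv] at this
    have h1 := hk.eventually (lt_mem_nhds (hc k))
    have h2 := hk.eventually (Metric.closedBall_mem_nhds (c k) hε)
    filter_upwards [h1, h2] with P h1 h2
    exact ⟨h1.le, by simpa [Real.dist_eq] using h2⟩
  obtain ⟨η, hη, hball⟩ := Metric.nhds_basis_closedBall.eventually_iff.1 hev
  -- The value 0 off the open set `W` only serves to make the weights globally measurable.
  refine ⟨η, hη, W.piecewise Λ₀ 0, ?_, fun P hP => ?_⟩
  · exact hcont.measurable_piecewise continuous_zero.continuousOn hWo.measurableSet
  · have hPη : P ∈ Metric.closedBall v η := by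
      rw [Metric.mem_closedBall, dist_pi_le_iff hη.le]
      intro k
      rw [dist_eq_norm]
      exact hP k
    obtain ⟨hPW, hk⟩ := hball hPη
    rw [Set.piecewise_eq_of_mem _ _ _ hPW]
    refine ⟨hk, ?_⟩
    simp only [hΛ₀, add_smul, Finset.sum_add_distrib]
    rw [← hAapply, ← mul_apply_eq_comp, Ring.mul_inverse_cancel _ hPW]
    simp

/-- An approximate version of Farkas' lemma. -/
theorem exists_functional_of_forall_nonneg_weights {J E : Type*} [Fintype J]
    [NormedAddCommGroup E] [NormedSpace ℝ E] (v : J → E) (b : J → ℝ)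
    (h : ∀ w : J → ℝ, (∀ j, 0 ≤ w j) → ∑ j, w j • v j = 0 → ∑ j, w j * b j ≤ 0) {ε : ℝ}
    (hε : 0 < ε) : ∃ f : E →L[ℝ] ℝ, ∀ j, b j - ε ≤ f (v j) := by
  set p : J → E × ℝ := fun j => (v j, b j - ε) with hp
  set H : Set (E × ℝ) := Fintype.linearCombination ℝ p '' stdSimplex ℝ J with hH
  have hHconv : Convex ℝ H := (convex_stdSimplex ℝ J).linear_image _
  have hHcomp : IsCompact H :=
    (isCompact_stdSimplex ℝ J).image (LinearMap.continuous_of_finiteDimensional _)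
  -- A point of `H` over 0 has height at most `-ε` by the hypothesis on weights, so the compact set
  -- `H` misses this closed half-line and can be strictly separated from it.
  set C : Set (E × ℝ) := {(0 : E)} ×ˢ Set.Ici (0 : ℝ) with hC
  have hCconv : Convex ℝ C := (convex_singleton _).prod (convex_Ici _)
  have hCcl : IsClosed C := isClosed_singleton.prod isClosed_Ici
  have hdisj : Disjoint H C := by
    rw [Set.disjoint_left]
    rintro _ ⟨w, hw, rfl⟩ ⟨h1, h2⟩
    simp only [Fintype.linearCombination_apply, hp, Prod.fst_sum, Prod.snd_sum, Prod.smul_mk,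
      Set.mem_singleton_iff, Set.mem_Ici, smul_eq_mul] at h1 h2
    have h3 := h w hw.1 h1
    simp only [mul_sub, Finset.sum_sub_distrib, ← Finset.sum_mul, hw.2] at h2
    linarith
  obtain ⟨g, u, u', hgH, huu, hgC⟩ :=
    geometric_hahn_banach_compact_closed hHconv hHcomp hCconv hCcl hdisj
  have hu'0 : u' < 0 := by
    have := hgC (0, 0) ⟨rfl, by simp⟩
    have h0 : ((0 : E), (0 : ℝ)) = 0 := rfl
    rwa [h0, map_zero] at this
  have hsplit : ∀ x s, g (x, s) = g (x, 0) + s * g (0, 1) := by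
    intro x s
    have : ((x, s) : E × ℝ) = (x, 0) + s • ((0 : E), (1 : ℝ)) := by simp
    rw [this, map_add, map_smul, smul_eq_mul]
  set τ := g (0, 1) with hτ
  have hτ0 : 0 ≤ τ := by
    by_contra! hneg
    have := hgC (0, u' / τ) ⟨rfl, (div_pos_of_neg_of_neg hu'0 hneg).le⟩
    rw [hsplit] at this
    have h0 : ((0 : E), (0 : ℝ)) = 0 := rfl
    rw [h0, map_zero, zero_add, div_mul_cancel₀ _ hneg.ne] at this
    exact lt_irrefl _ this
  have hvj : ∀ j, g (v j, 0) + (b j - ε) * τ < u := by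
    intro j
    classical
    rw [hτ, ← hsplit]
    refine hgH _ ⟨Pi.single j 1, single_mem_stdSimplex ℝ j, ?_⟩
    rw [Fintype.linearCombination_apply_single, one_smul]
  set f₀ : E →L[ℝ] ℝ := -(g.comp (ContinuousLinearMap.inl ℝ E ℝ)) with hf₀
  have hf₀v : ∀ x, f₀ x = -g (x, 0) := fun x => by simp [hf₀]
  -- If the separating hyperplane is vertical, `f₀` is bounded below by `-u > 0` on all `v j`, and a
  -- large multiple dominates every `b j`. Otherwise divide by `τ`.
  rcases hτ0.eq_or_lt with h0 | hpos
  · obtain ⟨B, hB⟩ := (Set.finite_range b).bddAbove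
    refine ⟨(max B 0 / (-u)) • f₀, fun j => ?_⟩
    have hBj : b j ≤ B := hB ⟨j, rfl⟩
    have h1 := hvj j
    rw [← h0, mul_zero, add_zero] at h1
    have hu : 0 < -u := by linarith
    have h2 : -u ≤ f₀ (v j) := by rw [hf₀v]; linarith
    have h3 : max B 0 / (-u) * (-u) ≤ max B 0 / (-u) * f₀ (v j) := by gcongr
    rw [div_mul_cancel₀ _ hu.ne'] at h3
    have := le_max_left B 0
    simp only [FunLike.coe_smul, Pi.smul_apply, smul_eq_mul]
    linarith
  · refine ⟨τ⁻¹ • f₀, fun j => ?_⟩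
    have h1 := hvj j
    have h2 : (b j - ε) * τ ≤ f₀ (v j) := by rw [hf₀v]; linarith
    simp only [FunLike.coe_smul, Pi.smul_apply, smul_eq_mul]
    rw [inv_mul_eq_div, le_div_iff₀ hpos]
    exact h2

/-! ### Homogeneous coordinates and convex hulls -/

/-- The affine embedding `y ↦ (1, y)`, which turns affine functions into linear ones. -/
def homogenize {d : ℕ} (y : Rd d) : ℝ × Rd d := (1, y)

theorem continuous_homogenize {d : ℕ} : Continuous (homogenize (d := d)) :=
  continuous_const.prodMk continuous_id

theorem homogenize_combo {d : ℕ} {a b : ℝ} (hab : a + b = 1) (y z : Rd d) :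
    homogenize (a • y + b • z) = a • homogenize y + b • homogenize z := by
  simp [homogenize, hab]

theorem sum_smul_homogenize {d : ℕ} {ι : Type*} (s : Finset ι) (c : ι → ℝ) (y : ι → Rd d)
    (h : ∑ i ∈ s, c i = 1) :
    ∑ i ∈ s, c i • homogenize (y i) = homogenize (∑ i ∈ s, c i • y i) := by
  simp only [homogenize, Prod.smul_mk, smul_eq_mul, mul_one]
  rw [Prod.ext_iff]
  simp [Prod.fst_sum, Prod.snd_sum, h]

/-- A concave lower bound on a set extends to its convex hull. -/
theorem le_apply_homogenize_of_mem_convexHull {d : ℕ} {S : Set (Rd d)}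
    (L : (ℝ × Rd d) →L[ℝ] ℝ) {C : ℝ} (h : ∀ y ∈ S, C ≤ L (homogenize y)) :
    ∀ y ∈ convexHull ℝ S, C ≤ L (homogenize y) := by
  refine fun y hy => (convexHull_min (t := {y | C ≤ L (homogenize y)}) h ?_) hy
  intro y hy z hz a b ha hb hab
  simp only [Set.mem_ofPred_eq] at *
  rw [homogenize_combo hab, map_add, map_smul, map_smul, smul_eq_mul, smul_eq_mul]
  calc C = a * C + b * C := by rw [← add_mul, hab, one_mul]
    _ ≤ _ := by gcongr

/-- Differences of `homogenize` along short segments from an interior point give every vector `(0,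
v)`; one point of `U` supplies the remaining coordinate. -/
theorem span_homogenize_of_interior_nonempty {d : ℕ} {U : Set (Rd d)}
    (hU : (interior U).Nonempty) : Submodule.span ℝ (homogenize '' U) = ⊤ := by
  obtain ⟨p, hp⟩ := hU
  obtain ⟨δ, hδ, hball⟩ := Metric.mem_nhds_iff.1 (mem_interior_iff_mem_nhds.1 hp)
  have hmem : ∀ y ∈ U, homogenize y ∈ Submodule.span ℝ (homogenize '' U) := fun y hy =>
    Submodule.subset_span ⟨y, hy, rfl⟩
  have hpU := hmem p (interior_subset hp)
  have hv : ∀ v : Rd d, ((0 : ℝ), v) ∈ Submodule.span ℝ (homogenize '' U) := by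
    intro v
    set s : ℝ := δ / (2 * (‖v‖ + 1)) with hs
    have hs0 : 0 < s := by positivity
    have hsv : p + s • v ∈ U := by
      refine hball ?_
      rw [Metric.mem_ball, dist_eq_norm, add_sub_cancel_left, norm_smul, Real.norm_eq_abs,
        abs_of_pos hs0, hs, div_mul_eq_mul_div, div_lt_iff₀ (by positivity)]
      nlinarith [norm_nonneg v]
    have h1 := Submodule.smul_mem _ s⁻¹ (Submodule.sub_mem _ (hmem _ hsv) hpU)
    simpa [homogenize, smul_smul, inv_mul_cancel₀ hs0.ne'] using h1
  rw [eq_top_iff]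
  rintro ⟨a, v⟩ -
  have := Submodule.add_mem _ (Submodule.smul_mem _ a hpU) (hv (v - a • p))
  simpa [homogenize] using this

theorem span_homogenize_convexHull_le {d : ℕ} (S : Set (Rd d)) :
    Submodule.span ℝ (homogenize '' convexHull ℝ S) ≤ Submodule.span ℝ (homogenize '' S) := by
  rw [Submodule.span_le]
  rintro _ ⟨y, hy, rfl⟩
  refine convexHull_min
    (t := {y | homogenize y ∈ Submodule.span ℝ (homogenize '' S)}) ?_ ?_ hy
  · exact fun z hz => Submodule.subset_span ⟨z, hz, rfl⟩
  · intro y hy z hz a b _ _ hab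
    simp only [Set.mem_ofPred_eq] at *
    rw [homogenize_combo hab]
    exact Submodule.add_mem _ (Submodule.smul_mem _ _ hy) (Submodule.smul_mem _ _ hz)

theorem exists_finset_span_homogenize {d : ℕ} {S : Set (Rd d)}
    (hS : (interior (convexHull ℝ S)).Nonempty) :
    ∃ T : Finset (Rd d), (T : Set (Rd d)) ⊆ S ∧
      Submodule.span ℝ (homogenize '' (T : Set (Rd d))) = ⊤ := by
  classical
  obtain ⟨b, hbS, hspan, hlin⟩ := exists_linearIndependent ℝ (homogenize '' S)
  have hfin : b.Finite := hlin.setFinite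
  obtain ⟨T, hTS, hTb⟩ := Set.subset_image_iff.1 hbS
  have hinj : Set.InjOn (homogenize (d := d)) T := fun x _ y _ h => (Prod.ext_iff.1 h).2
  have hTfin : T.Finite := by
    rw [← hTb] at hfin
    exact hfin.of_finite_image hinj
  refine ⟨hTfin.toFinset, by simpa using hTS, ?_⟩
  rw [hTfin.coe_toFinset, hTb, hspan, eq_top_iff, ← span_homogenize_of_interior_nonempty hS]
  exact span_homogenize_convexHull_le S

/-- An interior point of a convex hull is a convex combination with positive weights on any
prescribed finite subset. -/
theorem exists_pos_weights_of_mem_interior_convexHull {d : ℕ} {S : Set (Rd d)} {q : Rd d}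
    (hq : q ∈ interior (convexHull ℝ S)) (T : Finset (Rd d)) (hT : (T : Set (Rd d)) ⊆ S) :
    ∃ T' : Finset (Rd d), T ⊆ T' ∧ (T' : Set (Rd d)) ⊆ S ∧ ∃ c : Rd d → ℝ,
      (∀ y ∈ T', 0 < c y) ∧ ∑ y ∈ T', c y • homogenize y = homogenize q := by
  classical
  -- Reserve a small mass `s` for each point of `T`; as `q` is interior, the renormalized remainder
  -- stays in the hull and can be expanded over a finite subset of `S`.
  obtain ⟨s, hs, hsn, hsq⟩ : ∃ s : ℝ, 0 < s ∧ 0 < 1 - s * T.card ∧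
      (1 - s * T.card)⁻¹ • (q - s • ∑ y ∈ T, y) ∈ convexHull ℝ S := by
    have hc : ContinuousAt (fun s : ℝ => (1 - s * T.card)⁻¹ • (q - s • ∑ y ∈ T, y)) 0 := by
      have h : ContinuousAt (fun s : ℝ => 1 - s * (T.card : ℝ)) 0 :=
        Continuous.continuousAt (by fun_prop)
      exact (h.inv₀ (by simp)).smul (Continuous.continuousAt (by fun_prop))
    have hc' : ContinuousAt (fun s : ℝ => 1 - s * T.card) 0 :=
      Continuous.continuousAt (by fun_prop)
    have h1 := hc.eventually_mem (s := convexHull ℝ S)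
      (by simpa using mem_interior_iff_mem_nhds.1 hq)
    have h2 := hc'.eventually_mem (s := Set.Ioi 0) (Ioi_mem_nhds (by simp))
    obtain ⟨s, ⟨h1, h2⟩, h3⟩ :=
      (((h1.and h2).filter_mono nhdsWithin_le_nhds).and
        (self_mem_nhdsWithin : Set.Ioi (0 : ℝ) ∈ nhdsWithin 0 (Set.Ioi 0))).exists
    exact ⟨s, h3, h2, h1⟩
  set r := 1 - s * T.card with hr
  rw [convexHull_eq_union_convexHull_finite_subsets] at hsq
  simp only [Set.mem_iUnion, exists_prop] at hsq
  obtain ⟨t, htS, hqt⟩ := hsq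
  rw [Finset.mem_convexHull'] at hqt
  obtain ⟨w, hw0, hw1, hwq⟩ := hqt
  have hsum := sum_smul_homogenize t w id hw1
  simp only [id] at hsum
  rw [hwq] at hsum
  refine ⟨T ∪ t.filter (fun y => 0 < w y), Finset.subset_union_left, ?_,
    fun y => (if y ∈ T then s else 0) + r * (if y ∈ t then w y else 0), ?_, ?_⟩
  · intro y hy
    simp only [Finset.coe_union, Finset.coe_filter, Set.mem_union, Set.mem_ofPred_eq,
      Finset.mem_coe] at hy
    rcases hy with hy | hy
    · exact hT hy
    · exact htS hy.1
  · intro y hy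
    have hw' : 0 ≤ r * (if y ∈ t then w y else 0) := by
      refine mul_nonneg hsn.le ?_
      split_ifs with h
      · exact hw0 y h
      · exact le_rfl
    rcases Finset.mem_union.1 hy with hy | hy
    · simp only [hy, if_true]; linarith
    · obtain ⟨h1, h2⟩ := Finset.mem_filter.1 hy
      simp only [h1, if_true] at hw' ⊢
      have h3 := mul_pos hsn h2
      split_ifs <;> linarith
  · simp only [add_smul, Finset.sum_add_distrib, mul_smul, ite_smul, zero_smul,
      ← Finset.smul_sum]
    have e1 : ∑ y ∈ T ∪ t.filter (fun y => 0 < w y), (if y ∈ T then s • homogenize y else 0)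
        = ∑ y ∈ T, s • homogenize y := by
      rw [← Finset.sum_filter]
      congr 1
      ext y; simp
    have e2 : ∑ y ∈ T ∪ t.filter (fun y => 0 < w y), (if y ∈ t then w y • homogenize y else 0)
        = ∑ y ∈ t, w y • homogenize y := by
      rw [← Finset.sum_filter]
      refine Finset.sum_subset (fun y hy => (Finset.mem_filter.1 hy).2) fun y hy hy' => ?_
      have : w y = 0 := by
        by_contra h
        refine hy' (Finset.mem_filter.2 ⟨Finset.mem_union_right _ (Finset.mem_filter.2
          ⟨hy, lt_of_le_of_ne (hw0 y hy) (Ne.symm h)⟩), hy⟩)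
      rw [this, zero_smul]
    rw [e1, e2, hsum]
    have h1 : s * (T.card : ℝ) + r = 1 := by rw [hr]; ring
    simp only [homogenize, Prod.smul_mk, smul_smul, mul_inv_cancel₀ hsn.ne', one_smul,
      smul_eq_mul, mul_one]
    rw [Prod.ext_iff]
    simp only [Prod.fst_add, Prod.snd_add, Prod.fst_sum, Prod.snd_sum, Finset.sum_const,
      nsmul_eq_mul]
    constructor
    · linarith
    · rw [← Finset.smul_sum]; abel

/-! ### Martingale plans and exchange of parts -/

theorem integrable_fst_of_fst_eq {d : ℕ} {μ : Measure (Rd d)} {π : Measure (Rd d × Rd d)}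
    (hμ : Integrable (fun x : Rd d => x) μ) (hπ : π.fst = μ) :
    Integrable (fun z : Rd d × Rd d => z.1) π := by
  rw [← hπ] at hμ
  exact hμ.comp_measurable measurable_fst

theorem integrable_snd_of_snd_eq {d : ℕ} {ν : Measure (Rd d)} {π : Measure (Rd d × Rd d)}
    (hν : Integrable (fun x : Rd d => x) ν) (hπ : π.snd = ν) :
    Integrable (fun z : Rd d × Rd d => z.2) π := by
  rw [← hπ] at hν
  exact hν.comp_measurable measurable_snd

theorem setIntegral_snd_of_mem_MT {d : ℕ} {μ ν : Measure (Rd d)} [IsProbabilityMeasure μ]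
    (hν : Integrable (fun x : Rd d => x) ν) {π : Measure (Rd d × Rd d)} (hπ : π ∈ MT μ ν)
    {A : Set (Rd d)} (hA : MeasurableSet A) :
    ∫ z in A ×ˢ Set.univ, z.2 ∂π = ∫ x in A, x ∂μ := by
  obtain ⟨hfst, hsnd, κ, ⟨hκ, hdis⟩, hbar⟩ := hπ
  have hint := integrable_snd_of_snd_eq hν hsnd
  rw [hdis] at hint ⊢
  rw [Measure.setIntegral_compProd hA MeasurableSet.univ hint.integrableOn]
  refine integral_congr_ae (ae_restrict_of_ae ?_)
  filter_upwards [hbar] with x hx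
  rw [Measure.restrict_univ, hx.2]

/-- Fibre means are determined a.e. by their integrals over measurable sets. This turns the
martingale condition into one linear in `π`, which can be checked after subtracting and adding
parts. -/
theorem mem_MT_of_setIntegral_snd {d : ℕ} {μ ν : Measure (Rd d)} [IsProbabilityMeasure μ]
    (hμ : Integrable (fun x : Rd d => x) μ) (hν : Integrable (fun x : Rd d => x) ν)
    {π : Measure (Rd d × Rd d)} (hfst : π.fst = μ) (hsnd : π.snd = ν)
    (h : ∀ A : Set (Rd d), MeasurableSet A → ∫ z in A ×ˢ Set.univ, z.2 ∂π = ∫ x in A, x ∂μ) :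
    π ∈ MT μ ν := by
  have hfin : IsFiniteMeasure π := by
    constructor
    rw [← Measure.fst_univ, hfst]
    exact measure_lt_top μ _
  have hdis : π = μ ⊗ₘ π.condKernel := by
    rw [← hfst]
    exact (π.disintegrate π.condKernel).symm
  have hint := integrable_snd_of_snd_eq hν hsnd
  refine ⟨hfst, hsnd, π.condKernel, ⟨inferInstance, hdis⟩, ?_⟩
  have hint' := hint
  rw [hdis] at hint'
  have h1 := ((Measure.integrable_compProd_iff hint'.aestronglyMeasurable).1 hint').1
  have h2 : Integrable (fun x => ∫ y, y ∂(π.condKernel x)) μ := hint'.integral_compProd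
  have h3 : (fun x => ∫ y, y ∂(π.condKernel x)) =ᵐ[μ] fun x => x := by
    refine h2.ae_eq_of_forall_setIntegral_eq _ _ hμ fun A hA _ => ?_
    rw [← h A hA]
    conv_rhs => rw [hdis]
    rw [Measure.setIntegral_compProd hA MeasurableSet.univ hint'.integrableOn]
    simp only [Measure.restrict_univ]
  filter_upwards [h1, h3] with x hx1 hx3
  exact ⟨hx1, hx3⟩

/-- Exchanging a part `σ` of an optimal plan for a measure `σ'` with the same marginals and the
same barycentres does not improve the cost. -/
theorem integral_cost_le_of_le {d : ℕ} {μ ν : Measure (Rd d)} [IsProbabilityMeasure μ]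
    (hμ : Integrable (fun x : Rd d => x) μ) (hν : Integrable (fun x : Rd d => x) ν)
    {π : Measure (Rd d × Rd d)} (hπ : π ∈ MT μ ν) {s : ℝ}
    (hopt : ∀ π' ∈ MT μ ν, s * transportCost π' ≤ s * transportCost π)
    {σ σ' : Measure (Rd d × Rd d)} (hσ : σ ≤ π) (hfst : σ'.fst = σ.fst) (hsnd : σ'.snd = σ.snd)
    (hbar : ∀ A : Set (Rd d), MeasurableSet A →
      ∫ z in A ×ˢ Set.univ, z.2 ∂σ' = ∫ z in A ×ˢ Set.univ, z.2 ∂σ) :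
    s * ∫ z, ‖z.1 - z.2‖ ∂σ' ≤ s * ∫ z, ‖z.1 - z.2‖ ∂σ := by
  have hπfin : IsFiniteMeasure π := by
    constructor
    rw [← Measure.fst_univ, hπ.1]
    exact measure_lt_top μ _
  have hσfin : IsFiniteMeasure σ := isFiniteMeasure_of_le π hσ
  have hi1 := integrable_fst_of_fst_eq hμ hπ.1
  have hi2 := integrable_snd_of_snd_eq hν hπ.2.1
  set π₀ := π - σ with hπ₀
  have hadd : π₀ + σ = π := Measure.sub_add_cancel_of_le hσ
  have hmem : π₀ + σ' ∈ MT μ ν := by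
    have hf : (π₀ + σ').fst = μ := by
      rw [← hπ.1, ← hadd, Measure.fst_add, Measure.fst_add, hfst]
    have hs : (π₀ + σ').snd = ν := by
      rw [← hπ.2.1, ← hadd, Measure.snd_add, Measure.snd_add, hsnd]
    refine mem_MT_of_setIntegral_snd hμ hν hf hs fun A hA => ?_
    have hi' := integrable_snd_of_snd_eq hν hs
    rw [← setIntegral_snd_of_mem_MT hν hπ hA]
    rw [← hadd] at hi2
    conv_rhs => rw [← hadd]
    rw [Measure.restrict_add, Measure.restrict_add,
      integral_add_measure hi'.left_of_add_measure.integrableOn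
        hi'.right_of_add_measure.integrableOn,
      integral_add_measure hi2.left_of_add_measure.integrableOn
        hi2.right_of_add_measure.integrableOn, hbar A hA]
  have h := hopt _ hmem
  have hi1' := integrable_fst_of_fst_eq hμ hmem.1
  have hi2' := integrable_snd_of_snd_eq hν hmem.2.1
  have hc := (hi1.sub hi2).norm
  have hc' := (hi1'.sub hi2').norm
  rw [← hadd] at hc
  simp only [Pi.sub_apply] at hc hc'
  unfold transportCost at h
  conv_rhs at h => rw [← hadd]
  rw [integral_add_measure hc'.left_of_add_measure hc'.right_of_add_measure,
    integral_add_measure hc.left_of_add_measure hc.right_of_add_measure] at h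
  linarith

theorem integral_cost_le_of_le_smul {d : ℕ} {μ ν : Measure (Rd d)} [IsProbabilityMeasure μ]
    (hμ : Integrable (fun x : Rd d => x) μ) (hν : Integrable (fun x : Rd d => x) ν)
    {π : Measure (Rd d × Rd d)} (hπ : π ∈ MT μ ν) {s : ℝ}
    (hopt : ∀ π' ∈ MT μ ν, s * transportCost π' ≤ s * transportCost π)
    {σ σ' : Measure (Rd d × Rd d)} {C : NNReal} (hσ : σ ≤ C • π) (hfst : σ'.fst = σ.fst)
    (hsnd : σ'.snd = σ.snd)
    (hbar : ∀ A : Set (Rd d), MeasurableSet A →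
      ∫ z in A ×ˢ Set.univ, z.2 ∂σ' = ∫ z in A ×ˢ Set.univ, z.2 ∂σ) :
    s * ∫ z, ‖z.1 - z.2‖ ∂σ' ≤ s * ∫ z, ‖z.1 - z.2‖ ∂σ := by
  -- Scaling by `(C + 1)⁻¹` avoids a separate case `C = 0`; all conditions and the conclusion are
  -- homogeneous.
  have hD : 0 < C + 1 := by positivity
  have hle : (C + 1)⁻¹ • σ ≤ π := by
    intro B
    have h1 : σ B ≤ C * π B := by simpa using hσ B
    have h2 : σ B ≤ (C + 1 : NNReal) * π B := h1.trans (by gcongr; simp)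
    calc ((C + 1)⁻¹ • σ) B = ((C + 1)⁻¹ : NNReal) * σ B := by simp
      _ ≤ ((C + 1)⁻¹ : NNReal) * ((C + 1 : NNReal) * π B) := by gcongr
      _ = π B := by
        rw [← mul_assoc, ← ENNReal.coe_mul, inv_mul_cancel₀ hD.ne', ENNReal.coe_one, one_mul]
  have hmap : ∀ (f : Rd d × Rd d → Rd d) (τ : Measure (Rd d × Rd d)),
      ((C + 1)⁻¹ • τ).map f = (C + 1)⁻¹ • τ.map f := fun f τ => Measure.map_smul _ _ _
  have h := integral_cost_le_of_le (σ' := (C + 1)⁻¹ • σ') hμ hν hπ hopt hle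
    (by simp only [Measure.fst, hmap]; congr 1)
    (by simp only [Measure.snd, hmap]; congr 1)
    (fun A hA => by
      rw [Measure.restrict_smul, Measure.restrict_smul, integral_smul_nnreal_measure,
        integral_smul_nnreal_measure, hbar A hA])
  rw [integral_smul_nnreal_measure, integral_smul_nnreal_measure, NNReal.smul_def, NNReal.smul_def,
    smul_eq_mul, smul_eq_mul] at h
  have hpos : (0 : ℝ) < ((C + 1)⁻¹ : NNReal) := by positivity
  refine le_of_mul_le_mul_left ?_ hpos
  linarith

/-! ### Parts of a plan with prescribed fibre mass and barycentre -/

section WeightedPiece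

variable {X Y : Type*} [MeasurableSpace X] [MeasurableSpace Y]

/-- The part of `ρ ⊗ₘ κ` carried by `X × V`, with density `a` in the first variable. -/
noncomputable def weightedPiece (ρ : Measure X) (κ : Kernel X Y) {V : Set Y}
    (hV : MeasurableSet V) (a : X → NNReal) : Measure (X × Y) :=
  (ρ.withDensity fun x => (a x : ℝ≥0∞)) ⊗ₘ (κ.restrict hV)

variable {ρ : Measure X} {κ : Kernel X Y} {V : Set Y} {a : X → NNReal} {M : NNReal}

theorem withDensity_le_smul_of_le (haM : ∀ x, a x ≤ M) :
    (ρ.withDensity fun x => (a x : ℝ≥0∞)) ≤ M • ρ := by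
  intro B
  calc (ρ.withDensity fun x => (a x : ℝ≥0∞)) B
      ≤ (ρ.withDensity fun _ => (M : ℝ≥0∞)) B :=
        withDensity_mono (Filter.Eventually.of_forall fun x => by exact_mod_cast haM x) B
    _ = (M • ρ) B := by rw [withDensity_const]; rfl

theorem isFiniteMeasure_withDensity_of_le [IsFiniteMeasure ρ] (haM : ∀ x, a x ≤ M) :
    IsFiniteMeasure (ρ.withDensity fun x => (a x : ℝ≥0∞)) :=
  isFiniteMeasure_of_le _ (withDensity_le_smul_of_le haM)

theorem isFiniteMeasure_weightedPiece [IsFiniteMeasure ρ] [IsMarkovKernel κ] (hV : MeasurableSet V)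
    (haM : ∀ x, a x ≤ M) :
    IsFiniteMeasure (weightedPiece ρ κ hV a) := by
  have := isFiniteMeasure_withDensity_of_le (ρ := ρ) haM
  unfold weightedPiece
  infer_instance

theorem weightedPiece_le [IsFiniteMeasure ρ] [IsMarkovKernel κ] (hV : MeasurableSet V)
    (haM : ∀ x, a x ≤ M) :
    weightedPiece ρ κ hV a ≤ M • (ρ ⊗ₘ κ) := by
  have := isFiniteMeasure_withDensity_of_le (ρ := ρ) haM
  refine Measure.le_iff.2 fun B hB => ?_
  rw [weightedPiece, Measure.compProd_apply hB, Measure.smul_apply, Measure.compProd_apply hB]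
  calc ∫⁻ x, (κ.restrict hV) x (Prod.mk x ⁻¹' B) ∂(ρ.withDensity fun x => (a x : ℝ≥0∞))
      ≤ ∫⁻ x, κ x (Prod.mk x ⁻¹' B) ∂(M • ρ) := by
        refine lintegral_mono' (withDensity_le_smul_of_le haM) fun x => ?_
        rw [Kernel.restrict_apply]
        exact Measure.restrict_apply_le _ _
    _ = M • ∫⁻ x, κ x (Prod.mk x ⁻¹' B) ∂ρ := lintegral_smul_measure _ _

theorem weightedPiece_compl_prod [IsFiniteMeasure ρ] [IsMarkovKernel κ] (hV : MeasurableSet V)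
    (haM : ∀ x, a x ≤ M) {A : Set X} (hA : MeasurableSet A) (hρ : ρ Aᶜ = 0) :
    weightedPiece ρ κ hV a (A ×ˢ V)ᶜ = 0 := by
  have := isFiniteMeasure_withDensity_of_le (ρ := ρ) haM
  rw [weightedPiece, Measure.compProd_apply (hA.prod hV).compl]
  refine lintegral_eq_zero_of_ae_eq_zero ?_
  have h0 : ∀ᵐ x ∂ρ, x ∈ A := hρ
  filter_upwards [(withDensity_absolutelyContinuous ρ _).ae_le h0] with x hx
  rw [Kernel.restrict_apply' _ _ _ (measurable_prodMk_left (hA.prod hV).compl)]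
  have : Prod.mk x ⁻¹' (A ×ˢ V)ᶜ ∩ V = ∅ := by
    ext y
    simp only [Set.mem_inter_iff, Set.mem_preimage, Set.mem_compl_iff, Set.mem_prod,
      Set.mem_empty_iff_false, iff_false]
    tauto
  rw [this, measure_empty]
  rfl

/-- Used with `f = 1` for the mass and with `f = homogenize` for mass and barycentre together. -/
theorem setIntegral_weightedPiece [IsFiniteMeasure ρ] [IsMarkovKernel κ]
    (hV : MeasurableSet V) (ha : Measurable a) (haM : ∀ x, a x ≤ M) {F : Type*} [NormedAddCommGroup F] [NormedSpace ℝ F]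
    [CompleteSpace F] {f : Y → F} (hf : StronglyMeasurable f) {C : ℝ} (hfC : ∀ y ∈ V, ‖f y‖ ≤ C)
    {B : Set X} (hB : MeasurableSet B) :
    ∫ z in B ×ˢ Set.univ, f z.2 ∂(weightedPiece ρ κ hV a)
      = ∫ x in B, (a x : ℝ) • ∫ y in V, f y ∂(κ x) ∂ρ := by
  have hfin := isFiniteMeasure_withDensity_of_le (ρ := ρ) haM
  have hfin' := isFiniteMeasure_weightedPiece (ρ := ρ) (κ := κ) hV haM
  have hint : Integrable (fun z : X × Y => f z.2) (weightedPiece ρ κ hV a) := by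
    refine Integrable.of_bound (hf.comp_measurable measurable_snd).aestronglyMeasurable C ?_
    have := weightedPiece_compl_prod (κ := κ) hV haM MeasurableSet.univ
      (by simp : ρ (Set.univ : Set X)ᶜ = 0)
    filter_upwards [(mem_ae_iff.2 this : _ ∈ ae _)] with z hz
    exact hfC _ hz.2
  unfold weightedPiece at hint ⊢
  rw [Measure.setIntegral_compProd hB MeasurableSet.univ hint.integrableOn,
    setIntegral_withDensity_eq_setIntegral_smul ha _ hB]
  simp only [Measure.restrict_univ, Kernel.restrict_apply]
  rfl

end WeightedPiece

/-- Given points `y k` with positive weights `c k`, there are parts of `ρ ⊗ κ` carried by small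
neighbourhoods of the `y k` with almost the prescribed masses, such that for every `x` the total
mass and barycentre of the fibre over `x` are exactly the prescribed ones. -/
theorem exists_plans_near_points {d : ℕ} {K : Type*} [Fintype K] (y : K → Rd d)
    (hy : Submodule.span ℝ (Set.range fun k => homogenize (y k)) = ⊤) (c : K → ℝ)
    (hc : ∀ k, 0 < c k) {ε : ℝ} (hε : 0 < ε) :
    ∃ η > 0, ∀ (κ : Kernel (Rd d) (Rd d)) (_ : IsMarkovKernel κ) (ρ : Measure (Rd d))
      (_ : IsProbabilityMeasure ρ) (A : Set (Rd d)) (_ : MeasurableSet A) (_ : ρ Aᶜ = 0)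
      (V : K → Set (Rd d)) (_ : ∀ k, MeasurableSet (V k))
      (_ : ∀ k, V k ⊆ Metric.closedBall (y k) η) (δ : ℝ) (_ : 0 < δ)
      (_ : ∀ x ∈ A, ∀ k, δ ≤ (κ x).real (V k)),
      ∃ σ : K → Measure (Rd d × Rd d), (∀ k, IsFiniteMeasure (σ k)) ∧
        (∃ M : NNReal, ∀ k, σ k ≤ M • (ρ ⊗ₘ κ)) ∧ (∀ k, σ k (A ×ˢ V k)ᶜ = 0) ∧
        (∀ k, |(σ k).real Set.univ - c k| ≤ ε) ∧
        ∀ B : Set (Rd d), MeasurableSet B →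
          ∑ k, ∫ z in B ×ˢ Set.univ, homogenize z.2 ∂(σ k)
            = ρ.real B • ∑ k, c k • homogenize (y k) := by
  classical
  obtain ⟨η, hη, Λ, hΛm, hΛ⟩ :=
    exists_measurable_perturbed_weights (fun k => homogenize (y k)) hy c hc hε
  refine ⟨η, hη, fun κ hκ ρ hρ A hA hρA V hV hVη δ hδ hδV => ?_⟩
  have hbdd : ∀ k, ∃ C, ∀ z ∈ V k, ‖homogenize z‖ ≤ C := fun k =>
    ((isCompact_closedBall (y k) η).exists_bound_of_continuousOn
      continuous_homogenize.continuousOn).imp fun C hC z hz => hC z (hVη k hz)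
  choose Cb hCb using hbdd
  -- The mean of `homogenize` over `V k` under `κ x` is within `η` of its value at `y k`, so the
  -- perturbed weights apply fibre by fibre.
  set P : Rd d → K → ℝ × Rd d := fun x k =>
    ((κ x).real (V k))⁻¹ • ∫ z in V k, homogenize z ∂(κ x) with hP
  have hPm : Measurable P := by
    refine measurable_pi_iff.2 fun k => ?_
    have h1 : Measurable fun x => ((κ x).real (V k))⁻¹ :=
      ((κ.measurable_coe (hV k)).ennreal_toReal).inv
    have h2 : Measurable fun x => ∫ z in V k, homogenize z ∂(κ x) := by
      have h := (continuous_homogenize (d := d)).stronglyMeasurable.integral_kernel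
        (κ := κ.restrict (hV k))
      simpa [Kernel.restrict_apply] using h.measurable
    exact h1.smul h2
  have hPη : ∀ x ∈ A, ∀ k, ‖P x k - homogenize (y k)‖ ≤ η := by
    intro x hx k
    have hpos : 0 < (κ x).real (V k) := hδ.trans_le (hδV x hx k)
    have hint : IntegrableOn (fun z => homogenize z) (V k) (κ x) := by
      refine Measure.integrableOn_of_bounded (M := Cb k) (measure_ne_top _ _)
        continuous_homogenize.aestronglyMeasurable ?_
      exact (ae_restrict_iff' (hV k)).2 (Filter.Eventually.of_forall (hCb k))
    have h1 : P x k - homogenize (y k)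
        = ((κ x).real (V k))⁻¹ • ∫ z in V k, (homogenize z - homogenize (y k)) ∂(κ x) := by
      rw [integral_sub hint (by simp), setIntegral_const, smul_sub, smul_smul,
        inv_mul_cancel₀ hpos.ne', one_smul]
    rw [h1, norm_smul, norm_inv, Real.norm_of_nonneg hpos.le, inv_mul_le_iff₀ hpos, mul_comm]
    refine norm_setIntegral_le_of_norm_le_const (measure_lt_top _ _) fun z hz => ?_
    have := hVη k hz
    rw [Metric.mem_closedBall, dist_eq_norm] at this
    simpa [homogenize, Prod.norm_def, hη.le] using this
  have hAw := fun x (hx : x ∈ A) => hΛ (P x) (hPη x hx)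
  -- Dividing by the mass of `V k` gives the piece fibre mass `Λ (P x) k` and moment `Λ (P x) k • P
  -- x k`; the latter sum over `k` to a value independent of `x`. The lower bound `δ` on `A` keeps
  -- the density bounded.
  set a : K → Rd d → NNReal := fun k =>
    A.indicator fun x => (Λ (P x) k * ((κ x).real (V k))⁻¹).toNNReal with ha
  have ham : ∀ k, Measurable (a k) := by
    intro k
    refine Measurable.indicator ?_ hA
    refine Measurable.real_toNNReal (Measurable.mul ?_ ?_)
    · exact (measurable_pi_apply k).comp (hΛm.comp hPm)
    · exact ((κ.measurable_coe (hV k)).ennreal_toReal).inv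
  have haA : ∀ k, ∀ x ∈ A, (a k x : ℝ) = Λ (P x) k * ((κ x).real (V k))⁻¹ := by
    intro k x hx
    rw [ha]
    simp only [Set.indicator_of_mem hx]
    refine Real.coe_toNNReal _ (mul_nonneg ((hAw x hx).1 k).1 (by positivity))
  set M : NNReal := ((∑ k, c k + ε) * δ⁻¹).toNNReal with hM
  have hcsum : ∀ k, c k ≤ ∑ k, c k := fun k =>
    Finset.single_le_sum (fun i _ => (hc i).le) (Finset.mem_univ k)
  have haM : ∀ k x, a k x ≤ M := by
    intro k x
    by_cases hx : x ∈ A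
    · rw [← NNReal.coe_le_coe, haA k x hx, hM]
      refine le_trans ?_ (Real.le_coe_toNNReal _)
      have h1 := (abs_le.1 ((hAw x hx).1 k).2).2
      have h2 := hcsum k
      have h3 := ((hAw x hx).1 k).1
      gcongr
      · linarith
      · linarith
      · exact hδV x hx k
    · rw [ha]; simp [hx]
  have hae : ∀ᵐ x ∂ρ, x ∈ A := hρA
  refine ⟨fun k => weightedPiece ρ κ (hV k) (a k),
    fun k => isFiniteMeasure_weightedPiece (hV k) (haM k),
    ⟨M, fun k => weightedPiece_le (hV k) (haM k)⟩,
    fun k => weightedPiece_compl_prod (hV k) (haM k) hA hρA, fun k => ?_, fun B hB => ?_⟩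
  · have h1 := setIntegral_weightedPiece (ρ := ρ) (κ := κ) (hV k) (ham k) (haM k)
      (stronglyMeasurable_const (b := (1 : ℝ))) (C := 1) (fun _ _ => by simp) MeasurableSet.univ
    rw [Set.univ_prod_univ, setIntegral_const, smul_eq_mul, mul_one] at h1
    rw [h1, Measure.restrict_univ]
    have h2 : ∀ᵐ x ∂ρ, (a k x : ℝ) • ∫ _ in V k, (1 : ℝ) ∂(κ x) = Λ (P x) k := by
      filter_upwards [hae] with x hx
      have hpos : 0 < (κ x).real (V k) := hδ.trans_le (hδV x hx k)
      rw [setIntegral_const, haA k x hx, smul_eq_mul, smul_eq_mul, mul_one, mul_assoc,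
        inv_mul_cancel₀ hpos.ne', mul_one]
    rw [integral_congr_ae h2]
    have hΛi : Integrable (fun x => Λ (P x) k) ρ := by
      refine Integrable.of_bound
        ((measurable_pi_apply k).comp (hΛm.comp hPm)).aestronglyMeasurable (c k + ε) ?_
      filter_upwards [hae] with x hx
      rw [Real.norm_of_nonneg ((hAw x hx).1 k).1]
      linarith [(abs_le.1 ((hAw x hx).1 k).2).2]
    have h3 : ∫ x, Λ (P x) k ∂ρ - c k = ∫ x, (Λ (P x) k - c k) ∂ρ := by
      rw [integral_sub hΛi (integrable_const _)]; simp
    rw [h3, ← Real.norm_eq_abs]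
    have h4 := norm_integral_le_of_norm_le_const (μ := ρ) (C := ε)
      (f := fun x => Λ (P x) k - c k) (by
        filter_upwards [hae] with x hx
        exact ((hAw x hx).1 k).2)
    simpa using h4
  · have h1 : ∀ k, ∫ z in B ×ˢ Set.univ, homogenize z.2 ∂(weightedPiece ρ κ (hV k) (a k))
        = ∫ x in B, Λ (P x) k • P x k ∂ρ := by
      intro k
      rw [setIntegral_weightedPiece (ρ := ρ) (κ := κ) (hV k) (ham k) (haM k)
        continuous_homogenize.stronglyMeasurable (hCb k) hB]
      refine integral_congr_ae (ae_restrict_of_ae ?_)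
      filter_upwards [hae] with x hx
      rw [haA k x hx, mul_smul]
    simp_rw [h1]
    rw [← integral_finsetSum]
    · have h2 : ∀ᵐ x ∂(ρ.restrict B), ∑ k, Λ (P x) k • P x k = ∑ k, c k • homogenize (y k) := by
        refine ae_restrict_of_ae ?_
        filter_upwards [hae] with x hx using (hAw x hx).2
      rw [integral_congr_ae h2, setIntegral_const]
    · intro k _
      refine Integrable.integrableOn (Integrable.of_bound (Measurable.aestronglyMeasurable ?_)
        ((c k + ε) * (η + ‖homogenize (y k)‖)) ?_)
      · exact ((measurable_pi_apply k).comp (hΛm.comp hPm)).smul ((measurable_pi_apply k).comp hPm)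
      · filter_upwards [hae] with x hx
        rw [norm_smul, Real.norm_of_nonneg ((hAw x hx).1 k).1]
        have h1 := (abs_le.1 ((hAw x hx).1 k).2).2
        have h2 : ‖P x k‖ ≤ η + ‖homogenize (y k)‖ := by
          have := norm_add_le (P x k - homogenize (y k)) (homogenize (y k))
          rw [sub_add_cancel] at this
          linarith [hPη x hx k]
        have h3 := hc k
        gcongr
        linarith

/-! ### Redistribution of finitely many parts -/

theorem Measure.snd_finsetSum {X Y J : Type*} [MeasurableSpace X] [MeasurableSpace Y]
    (t : Finset J) (m : J → Measure (X × Y)) :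
    (∑ j ∈ t, m j).snd = ∑ j ∈ t, (m j).snd := by
  classical
  induction t using Finset.induction_on with
  | empty => simp
  | insert j t hj ih => rw [Finset.sum_insert hj, Finset.sum_insert hj, Measure.snd_add, ih]

theorem setIntegral_finsetSum_measure {X F J : Type*} [MeasurableSpace X] [NormedAddCommGroup F]
    [NormedSpace ℝ F] {t : Finset J} {m : J → Measure X} {f : X → F}
    (hf : ∀ j ∈ t, Integrable f (m j)) (B : Set X) :
    ∫ z in B, f z ∂(∑ j ∈ t, m j) = ∑ j ∈ t, ∫ z in B, f z ∂(m j) := by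
  have h : (∑ j ∈ t, m j).restrict B = ∑ j ∈ t, (m j).restrict B := by
    ext A hA
    simp [Measure.restrict_apply hA]
  rw [h]
  exact integral_finsetSum_measure fun j hj => (hf j hj).integrableOn

/-- Redistributing finitely many parts `σ j` of an optimal plan, where the `j`-th part receives
the new first marginal `ρ j`, does not improve the cost if total masses and barycentres are
preserved. -/
theorem sum_integral_cost_prod_le {d : ℕ} {μ ν : Measure (Rd d)} [IsProbabilityMeasure μ]
    (hμ : Integrable (fun x : Rd d => x) μ) (hν : Integrable (fun x : Rd d => x) ν)
    {π : Measure (Rd d × Rd d)} (hπ : π ∈ MT μ ν) {s : ℝ}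
    (hopt : ∀ π' ∈ MT μ ν, s * transportCost π' ≤ s * transportCost π)
    {J : Type*} [Fintype J] (σ : J → Measure (Rd d × Rd d)) (ρ : J → Measure (Rd d))
    [∀ j, IsFiniteMeasure (σ j)] [∀ j, IsProbabilityMeasure (ρ j)]
    (hρ : ∀ j, Integrable (fun x => x) (ρ j)) {M : NNReal} (hM : ∀ j, σ j ≤ M • π)
    (hbal : ∀ B : Set (Rd d), MeasurableSet B →
      ∑ j, ∫ z in B ×ˢ Set.univ, homogenize z.2 ∂(σ j)
        = ∑ j, (ρ j).real B • ∫ z, homogenize z.2 ∂(σ j)) :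
    s * ∑ j, ∫ z, ‖z.1 - z.2‖ ∂((ρ j).prod (σ j).snd) ≤ s * ∑ j, ∫ z, ‖z.1 - z.2‖ ∂(σ j) := by
  have hi1 := integrable_fst_of_fst_eq hμ hπ.1
  have hi2 := integrable_snd_of_snd_eq hν hπ.2.1
  have hσ1 : ∀ j, Integrable (fun z : Rd d × Rd d => z.1) (σ j) := fun j =>
    (hi1.smul_measure_nnreal (c := M)).mono_measure (hM j)
  have hσ2 : ∀ j, Integrable (fun z : Rd d × Rd d => z.2) (σ j) := fun j =>
    (hi2.smul_measure_nnreal (c := M)).mono_measure (hM j)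
  have hσc : ∀ j, Integrable (fun z : Rd d × Rd d => ‖z.1 - z.2‖) (σ j) := fun j =>
    ((hσ1 j).sub (hσ2 j)).norm
  -- The product keeps the second marginal of each part while replacing the first by a multiple of
  -- `ρ j`.
  set σ' : J → Measure (Rd d × Rd d) := fun j => (ρ j).prod (σ j).snd with hσ'
  have hsnd2 : ∀ j, Integrable (fun y : Rd d => y) (σ j).snd := fun j =>
    (integrable_map_measure aestronglyMeasurable_id measurable_snd.aemeasurable).2 (hσ2 j)
  have hσ'1 : ∀ j, Integrable (fun z : Rd d × Rd d => z.1) (σ' j) := fun j =>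
    (hρ j).comp_fst _
  have hσ'2 : ∀ j, Integrable (fun z : Rd d × Rd d => z.2) (σ' j) := fun j =>
    (hsnd2 j).comp_snd _
  have hσ'c : ∀ j, Integrable (fun z : Rd d × Rd d => ‖z.1 - z.2‖) (σ' j) := fun j =>
    ((hσ'1 j).sub (hσ'2 j)).norm
  have hh : ∀ j, Integrable (fun z : Rd d × Rd d => homogenize z.2) (σ j) := fun j =>
    (integrable_const (1 : ℝ)).prodMk (hσ2 j)
  have hh' : ∀ j, Integrable (fun z : Rd d × Rd d => homogenize z.2) (σ' j) := fun j =>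
    (integrable_const (1 : ℝ)).prodMk (hσ'2 j)
  have hkey : ∀ B : Set (Rd d), MeasurableSet B →
      ∫ z in B ×ˢ Set.univ, homogenize z.2 ∂(∑ j, σ' j)
        = ∫ z in B ×ˢ Set.univ, homogenize z.2 ∂(∑ j, σ j) := by
    intro B hB
    rw [setIntegral_finsetSum_measure (fun j _ => hh j),
      setIntegral_finsetSum_measure (fun j _ => hh' j), hbal B hB]
    refine Finset.sum_congr rfl fun j _ => ?_
    rw [hσ']
    rw [← Measure.prod_restrict, Measure.restrict_univ, integral_fun_snd,
      measureReal_restrict_apply_univ]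
    congr 1
    exact integral_map measurable_snd.aemeasurable continuous_homogenize.aestronglyMeasurable
  have hsum : ∀ (m : J → Measure (Rd d × Rd d)) [∀ j, IsFiniteMeasure (m j)],
      IsFiniteMeasure (∑ j, m j) := fun m _ => inferInstance
  have hσfin := hsum σ
  have hσ'fin := hsum σ'
  have hhs : Integrable (fun z : Rd d × Rd d => homogenize z.2) (∑ j, σ j) :=
    integrable_finsetSum_measure.2 fun j _ => hh j
  have hhs' : Integrable (fun z : Rd d × Rd d => homogenize z.2) (∑ j, σ' j) :=
    integrable_finsetSum_measure.2 fun j _ => hh' j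
  have hfst : (∑ j, σ' j).fst = (∑ j, σ j).fst := by
    ext B hB
    -- The first component of the balance identity is equality of first marginals; the second
    -- component is the barycentre condition.
    have h1 := congrArg Prod.fst (hkey B hB)
    rw [fst_integral hhs.integrableOn, fst_integral hhs'.integrableOn] at h1
    simp only [homogenize, setIntegral_const, smul_eq_mul, mul_one] at h1
    rw [Measure.fst_apply hB, Measure.fst_apply hB, ← Set.prod_univ]
    exact (measureReal_eq_measureReal_iff).1 h1
  have hsnd : (∑ j, σ' j).snd = (∑ j, σ j).snd := by
    rw [Measure.snd_finsetSum, Measure.snd_finsetSum]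
    refine Finset.sum_congr rfl fun j _ => ?_
    rw [hσ', Measure.snd_prod]
  have hle : ∑ j, σ j ≤ (Fintype.card J * M : NNReal) • π := by
    intro B
    rw [Measure.finsetSum_apply, mul_smul, Measure.smul_apply]
    calc ∑ j, σ j B ≤ ∑ _j : J, (M • π) B := Finset.sum_le_sum fun j _ => hM j B
      _ = _ := by
        rw [Finset.sum_const, Finset.card_univ, nsmul_eq_mul]; rfl
  have := integral_cost_le_of_le_smul hμ hν hπ hopt hle hfst hsnd fun B hB => by
    have h1 := congrArg Prod.snd (hkey B hB)
    rw [snd_integral hhs.integrableOn, snd_integral hhs'.integrableOn] at h1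
    exact h1
  rwa [integral_finsetSum_measure fun j _ => hσc j,
    integral_finsetSum_measure fun j _ => hσ'c j] at this

theorem abs_integral_cost_sub_le {d : ℕ} {m : Measure (Rd d × Rd d)} [IsFiniteMeasure m]
    {A V : Set (Rd d)} (hm : m (A ×ˢ V)ᶜ = 0) {a r : ℝ}
    (h : ∀ x ∈ A, ∀ y ∈ V, |‖x - y‖ - a| ≤ r) :
    |∫ z, ‖z.1 - z.2‖ ∂m - m.real Set.univ * a| ≤ r * m.real Set.univ := by
  have hae : ∀ᵐ z ∂m, z ∈ A ×ˢ V := hm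
  have hc : Continuous fun z : Rd d × Rd d => ‖z.1 - z.2‖ := by fun_prop
  have hi : Integrable (fun z : Rd d × Rd d => ‖z.1 - z.2‖) m := by
    refine Integrable.of_bound hc.aestronglyMeasurable (r + |a|) ?_
    filter_upwards [hae] with z hz
    have h1 := h _ hz.1 _ hz.2
    rw [norm_norm]
    have h2 := abs_sub_abs_le_abs_sub ‖z.1 - z.2‖ a
    rw [abs_of_nonneg (norm_nonneg _)] at h2
    linarith
  have h1 : ∫ z, ‖z.1 - z.2‖ ∂m - m.real Set.univ * a = ∫ z, (‖z.1 - z.2‖ - a) ∂m := by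
    rw [integral_sub hi (integrable_const _)]; simp
  rw [h1, ← Real.norm_eq_abs]
  refine norm_integral_le_of_norm_le_const ?_
  filter_upwards [hae] with z hz using h _ hz.1 _ hz.2

/-! ### Good points -/

/-- A point `x` is a continuity point of `κ` in a weak sense: whenever finitely many basic open
sets have mass larger than `1 / (n + 1)` for `κ x`, the same holds for many points near `x`. -/
def IsGoodPoint {d : ℕ} (μ : Measure (Rd d)) (κ : Kernel (Rd d) (Rd d)) (x : Rd d) : Prop :=
  ∀ (𝓕 : Finset (TopologicalSpace.countableBasis (Rd d))) (n : ℕ),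
    (∀ V ∈ 𝓕, ((n : ℝ) + 1)⁻¹ < (κ x).real V) →
      x ∈ (μ.restrict {x' | ∀ V ∈ 𝓕, ((n : ℝ) + 1)⁻¹ < (κ x').real V}).support

theorem measurableSet_forall_lt_kernel {d : ℕ} (κ : Kernel (Rd d) (Rd d))
    (𝓕 : Finset (TopologicalSpace.countableBasis (Rd d))) (r : ℝ) :
    MeasurableSet {x' | ∀ V ∈ 𝓕, r < (κ x').real V} := by
  have : {x' | ∀ V ∈ 𝓕, r < (κ x').real V} = ⋂ V ∈ 𝓕, {x' | r < (κ x').real V} := by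
    ext; simp
  rw [this]
  refine Finset.measurableSet_biInter _ fun V _ => ?_
  have hV : MeasurableSet (V : Set (Rd d)) :=
    (TopologicalSpace.isOpen_of_mem_countableBasis V.2).measurableSet
  exact measurableSet_lt measurable_const (κ.measurable_coe hV).ennreal_toReal

/-- There are countably many pairs `(𝓕, n)`, and for each the restricted measure is carried by its
support. -/
theorem ae_isGoodPoint {d : ℕ} (μ : Measure (Rd d)) (κ : Kernel (Rd d) (Rd d)) :
    ∀ᵐ x ∂μ, IsGoodPoint μ κ x := by
  have hc : Countable (TopologicalSpace.countableBasis (Rd d)) :=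
    (TopologicalSpace.countable_countableBasis _).to_subtype
  unfold IsGoodPoint
  rw [ae_all_iff]
  intro 𝓕
  rw [ae_all_iff]
  intro n
  exact (ae_restrict_iff' (measurableSet_forall_lt_kernel κ 𝓕 _)).1 Measure.support_mem_ae

/-- Basic neighbourhoods of the finitely many `y k` have positive `κ x`-mass, hence exceed a common
threshold `1 / (n + 1)`; goodness of `x` keeps this threshold on a set of positive measure near `x`.
-/
theorem IsGoodPoint.exists_cell {d : ℕ} {μ : Measure (Rd d)} {κ : Kernel (Rd d) (Rd d)}
    [IsMarkovKernel κ] {x : Rd d} (hx : IsGoodPoint μ κ x) {K : Type*} [Fintype K]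
    {y : K → Rd d} (hy : ∀ k, y k ∈ (κ x).support) {η : ℝ} (hη : 0 < η) :
    ∃ (A : Set (Rd d)) (V : K → Set (Rd d)) (δ : ℝ), MeasurableSet A ∧ A ⊆ Metric.ball x η ∧
      μ A ≠ 0 ∧ (∀ k, MeasurableSet (V k)) ∧ (∀ k, V k ⊆ Metric.ball (y k) η) ∧ 0 < δ ∧
      ∀ x' ∈ A, ∀ k, δ ≤ (κ x').real (V k) := by
  classical
  have hV : ∀ k, ∃ V : TopologicalSpace.countableBasis (Rd d),
      y k ∈ (V : Set (Rd d)) ∧ (V : Set (Rd d)) ⊆ Metric.ball (y k) η := fun k => by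
    obtain ⟨V, hV, h1, h2⟩ := (TopologicalSpace.isBasis_countableBasis
      (Rd d)).exists_subset_of_mem_open (Metric.mem_ball_self hη) Metric.isOpen_ball
    exact ⟨⟨V, hV⟩, h1, h2⟩
  choose V hyV hVη using hV
  have hVo : ∀ k, IsOpen (V k : Set (Rd d)) := fun k =>
    TopologicalSpace.isOpen_of_mem_countableBasis (V k).2
  have hpos : ∀ k, 0 < (κ x).real (V k) := fun k =>
    ENNReal.toReal_pos ((Measure.mem_support_iff_forall _).1 (hy k) _
      ((hVo k).mem_nhds (hyV k))).ne' (measure_ne_top _ _)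
  obtain ⟨n, hn⟩ : ∃ n : ℕ, ∀ k, ((n : ℝ) + 1)⁻¹ < (κ x).real (V k) := by
    have h : ∀ k, ∀ᶠ n : ℕ in Filter.atTop, ((n : ℝ) + 1)⁻¹ < (κ x).real (V k) := fun k => by
      have := tendsto_one_div_add_atTop_nhds_zero_nat (𝕜 := ℝ)
      simp only [one_div] at this
      exact this.eventually (gt_mem_nhds (hpos k))
    exact (Filter.eventually_all.2 h).exists
  set 𝓕 := Finset.univ.image V with h𝓕
  set A₀ := {x' | ∀ W ∈ 𝓕, ((n : ℝ) + 1)⁻¹ < (κ x').real W} with hA₀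
  have hA₀m : MeasurableSet A₀ := measurableSet_forall_lt_kernel κ 𝓕 _
  have hsupp := hx 𝓕 n (by simpa [h𝓕] using hn)
  have hball := (Measure.mem_support_iff_forall _).1 hsupp _ (Metric.ball_mem_nhds x hη)
  rw [Measure.restrict_apply Metric.isOpen_ball.measurableSet] at hball
  refine ⟨Metric.ball x η ∩ A₀, fun k => V k, ((n : ℝ) + 1)⁻¹,
    Metric.isOpen_ball.measurableSet.inter hA₀m, Set.inter_subset_left, hball.ne',
    fun k => (hVo k).measurableSet, hVη, by positivity, fun x' hx' k => ?_⟩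
  exact (hx'.2 (V k) (by simp [h𝓕])).le

theorem compProd_le_smul_of_le {X Y : Type*} [MeasurableSpace X] [MeasurableSpace Y]
    {ρ μ : Measure X} [SFinite ρ] [SFinite μ] {κ : Kernel X Y} [IsSFiniteKernel κ] {M : NNReal}
    (h : ρ ≤ M • μ) : ρ ⊗ₘ κ ≤ M • (μ ⊗ₘ κ) := by
  refine Measure.le_iff.2 fun B hB => ?_
  rw [Measure.compProd_apply hB, Measure.smul_apply, Measure.compProd_apply hB]
  calc ∫⁻ x, κ x (Prod.mk x ⁻¹' B) ∂ρ ≤ ∫⁻ x, κ x (Prod.mk x ⁻¹' B) ∂(M • μ) :=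
        lintegral_mono' h le_rfl
    _ = M • ∫⁻ x, κ x (Prod.mk x ⁻¹' B) ∂μ := lintegral_smul_measure _ _

theorem exists_cond_le_smul {X : Type*} [MeasurableSpace X] {μ : Measure X} [IsFiniteMeasure μ]
    {A : Set X} (hA : μ A ≠ 0) : ∃ M : NNReal, cond μ A ≤ M • μ := by
  refine ⟨(μ A).toNNReal⁻¹, fun B => ?_⟩
  have h2 : (((μ A).toNNReal⁻¹ : NNReal) : ℝ≥0∞) = (μ A)⁻¹ := by
    rw [ENNReal.coe_inv, ENNReal.coe_toNNReal (measure_ne_top _ _)]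
    exact (ENNReal.toNNReal_pos hA (measure_ne_top _ _)).ne'
  simp only [ProbabilityTheory.cond, Measure.smul_apply, smul_eq_mul, ENNReal.smul_def, h2]
  gcongr
  exact Measure.restrict_le_self

/-! ### Finite optimality and potentials for finitely many fibres -/

/-- The supports of the fibres over good points are finitely optimal. -/
theorem sum_weights_cost_le_zero_of_pos {d : ℕ} {μ ν : Measure (Rd d)} [IsProbabilityMeasure μ]
    (hμ : Integrable (fun x : Rd d => x) μ) (hν : Integrable (fun x : Rd d => x) ν)
    {π : Measure (Rd d × Rd d)} (hπ : π ∈ MT μ ν) {s : ℝ} (hs : |s| = 1)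
    (hopt : ∀ π' ∈ MT μ ν, s * transportCost π' ≤ s * transportCost π)
    {κ : Kernel (Rd d) (Rd d)} (hκ : IsDisintegration π μ κ)
    {I : Type*} [Fintype I] (K : I → Type*) [∀ i, Fintype (K i)] (x : I → Rd d)
    (hx : ∀ i, IsGoodPoint μ κ (x i)) (y : ∀ i, K i → Rd d)
    (hy : ∀ i k, y i k ∈ (κ (x i)).support)
    (hspan : ∀ i, Submodule.span ℝ (Set.range fun k => homogenize (y i k)) = ⊤)
    (c : ∀ i, I → K i → ℝ) (hc : ∀ i i' k, 0 < c i i' k)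
    (hbal : ∀ i, ∑ i', ∑ k, c i i' k • homogenize (y i k)
      = ∑ i', ∑ k, c i' i k • homogenize (y i' k)) :
    ∑ i, ∑ i', ∑ k, c i i' k * (s * ‖x i' - y i k‖ - s * ‖x i - y i k‖) ≤ 0 := by
  classical
  obtain ⟨hκM, hdis⟩ := hκ
  set g : ∀ i, I → K i → ℝ := fun i i' k => s * ‖x i' - y i k‖ - s * ‖x i - y i k‖ with hg
  -- The exchange is realized by actual parts of `π` with masses within `ε` of `c`. In small cells
  -- the cost varies by at most `2 * ε` both before and after the move, whence `4 * ε`.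
  have key : ∀ ε : ℝ, 0 < ε → ∑ i, ∑ i', ∑ k, c i i' k * g i i' k
      ≤ ∑ i, ∑ i', ∑ k, (ε * |g i i' k| + 4 * ε * (c i i' k + ε)) := by
    intro ε hε
    have h0 := fun i i' => exists_plans_near_points (y i) (hspan i) (c i i') (hc i i') hε
    choose η hη h0 using h0
    obtain ⟨η₀, hη₀, hη₀ε, hη₀η⟩ : ∃ η₀ : ℝ, 0 < η₀ ∧ η₀ ≤ ε ∧ ∀ i i', η₀ ≤ η i i' := by
      have h1 : ∀ᶠ r in nhdsWithin (0 : ℝ) (Set.Ioi 0), r ≤ ε ∧ ∀ i i', r ≤ η i i' := by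
        refine Filter.Eventually.filter_mono nhdsWithin_le_nhds ((ge_mem_nhds hε).and ?_)
        exact Filter.eventually_all.2 fun i => Filter.eventually_all.2 fun i' =>
          ge_mem_nhds (hη i i')
      obtain ⟨r, ⟨h1, h2⟩, h3⟩ := (h1.and self_mem_nhdsWithin).exists
      exact ⟨r, h3, h1, h2⟩
    have h1 := fun i => (hx i).exists_cell (hy i) hη₀
    choose A V δ hAm hAη hA0 hVm hVη hδ hδV using h1
    set ρ : I → Measure (Rd d) := fun i => cond μ (A i) with hρ
    have hρp : ∀ i, IsProbabilityMeasure (ρ i) := fun i => cond_isProbabilityMeasure (hA0 i)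
    have hρA : ∀ i, ρ i (A i)ᶜ = 0 := fun i => by
      rw [hρ]; simp [cond_apply (hAm i)]
    have hρle := fun i => exists_cond_le_smul (hA0 i)
    choose Mρ hMρ using hρle
    have h2 : ∀ i i', ∃ σ : K i → Measure (Rd d × Rd d), (∀ k, IsFiniteMeasure (σ k)) ∧
        (∃ M : NNReal, ∀ k, σ k ≤ M • (ρ i ⊗ₘ κ)) ∧ (∀ k, σ k (A i ×ˢ V i k)ᶜ = 0) ∧
        (∀ k, |(σ k).real Set.univ - c i i' k| ≤ ε) ∧
        ∀ B : Set (Rd d), MeasurableSet B →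
          ∑ k, ∫ z in B ×ˢ Set.univ, homogenize z.2 ∂(σ k)
            = (ρ i).real B • ∑ k, c i i' k • homogenize (y i k) := fun i i' =>
      h0 i i' κ hκM (ρ i) (hρp i) (A i) (hAm i) (hρA i) (V i) (hVm i)
        (fun k => (hVη i k).trans (Metric.ball_subset_closedBall.trans
          (Metric.closedBall_subset_closedBall (hη₀η i i')))) (δ i) (hδ i) (hδV i)
    choose σ hσf hM hσV hσm hσB using h2
    choose M hσM using hM
    -- The part `(i, i', k)` is taken near `(x i, y i k)` and moved over the cell of `x i'`.
    let J := Σ i : I, I × K i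
    set σJ : J → Measure (Rd d × Rd d) := fun j => σ j.1 j.2.1 j.2.2 with hσJ
    have hσJf : ∀ j, IsFiniteMeasure (σJ j) := fun j => hσf _ _ _
    have hsumJ : ∀ {F : Type} [AddCommMonoid F] (f : ∀ i, I → K i → F),
        ∑ j : J, f j.1 j.2.1 j.2.2 = ∑ i, ∑ i', ∑ k, f i i' k := by
      intro F _ f
      rw [Fintype.sum_sigma]
      exact Finset.sum_congr rfl fun i _ => Fintype.sum_prod_type _
    obtain ⟨M', hM'⟩ : ∃ M' : NNReal, ∀ i i', M i i' * Mρ i ≤ M' := by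
      obtain ⟨M', h⟩ := (Set.finite_range fun p : I × I => M p.1 p.2 * Mρ p.1).bddAbove
      exact ⟨M', fun i i' => h ⟨(i, i'), rfl⟩⟩
    have hle : ∀ j : J, σJ j ≤ M' • π := by
      rintro ⟨i, i', k⟩ B
      have h3 := compProd_le_smul_of_le (κ := κ) (hMρ i) B
      rw [← hdis] at h3
      calc σ i i' k B ≤ M i i' * (ρ i ⊗ₘ κ) B := by simpa using hσM i i' k B
        _ ≤ M i i' * (Mρ i * π B) := by gcongr; simpa using h3
        _ = (M i i' * Mρ i : NNReal) * π B := by push_cast; ring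
        _ ≤ (M' : NNReal) * π B := by gcongr; exact hM' i i'
        _ = (M' • π) B := by simp
    have hρi : ∀ i, Integrable (fun z : Rd d => z) (ρ i) := fun i =>
      (hμ.smul_measure_nnreal (c := Mρ i)).mono_measure (hMρ i)
    have hJ : ∀ j : J, IsProbabilityMeasure (ρ j.2.1) := fun j => hρp _
    have hbalJ : ∀ B : Set (Rd d), MeasurableSet B →
        ∑ j, ∫ z in B ×ˢ Set.univ, homogenize z.2 ∂(σJ j)
          = ∑ j : J, (ρ j.2.1).real B • ∫ z, homogenize z.2 ∂(σJ j) := by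
      intro B hB
      have e1 := hsumJ fun i i' k => ∫ z in B ×ˢ Set.univ, homogenize z.2 ∂(σ i i' k)
      have e2 := hsumJ fun i i' k => (ρ i').real B • ∫ z, homogenize z.2 ∂(σ i i' k)
      refine e1.trans (Eq.trans ?_ e2.symm)
      have e3 : ∀ i i', ∑ k, (ρ i').real B • ∫ z, homogenize z.2 ∂(σ i i' k)
          = (ρ i').real B • ∑ k, c i i' k • homogenize (y i k) := by
        intro i i'
        rw [← Finset.smul_sum]
        congr 1
        have := hσB i i' Set.univ MeasurableSet.univ
        simpa using this
      simp_rw [hσB _ _ B hB, e3]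
      rw [Finset.sum_comm (f := fun i i' => (ρ i').real B • ∑ k, c i i' k • homogenize (y i k))]
      refine Finset.sum_congr rfl fun i _ => ?_
      rw [← Finset.smul_sum, ← Finset.smul_sum, hbal i]
    have hmain := sum_integral_cost_prod_le hμ hν hπ hopt σJ (fun j => ρ j.2.1)
      (fun j => hρi _) hle hbalJ
    have hdist : ∀ i i' k, ∀ a ∈ A i', ∀ b ∈ V i k, |‖a - b‖ - ‖x i' - y i k‖| ≤ 2 * ε := by
      intro i i' k a ha b hb
      have h3 := hAη i' ha
      have h4 := hVη i k hb
      rw [Metric.mem_ball, dist_eq_norm] at h3 h4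
      have h5 := abs_norm_sub_norm_le (a - b) (x i' - y i k)
      have h6 : a - b - (x i' - y i k) = (a - x i') - (b - y i k) := by abel
      rw [h6] at h5
      have h7 := norm_sub_le (a - x i') (b - y i k)
      linarith
    have hsrc : ∀ i i' k, |∫ z, ‖z.1 - z.2‖ ∂(σ i i' k)
        - (σ i i' k).real Set.univ * ‖x i - y i k‖| ≤ 2 * ε * (σ i i' k).real Set.univ := by
      intro i i' k
      exact abs_integral_cost_sub_le (hσV i i' k) fun a ha b hb => hdist i i k a ha b hb
    have hdst : ∀ i i' k, |∫ z, ‖z.1 - z.2‖ ∂((ρ i').prod (σ i i' k).snd)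
        - (σ i i' k).real Set.univ * ‖x i' - y i k‖| ≤ 2 * ε * (σ i i' k).real Set.univ := by
      intro i i' k
      have hmass : ((ρ i').prod (σ i i' k).snd).real Set.univ = (σ i i' k).real Set.univ := by
        rw [← Set.univ_prod_univ, measureReal_prod_prod, probReal_univ, one_mul,
          Set.univ_prod_univ, measureReal_def, measureReal_def, Measure.snd_univ]
      rw [← hmass]
      refine abs_integral_cost_sub_le (A := A i') (V := V i k) ?_ fun a ha b hb =>
        hdist i i' k a ha b hb
      have h3 : (σ i i' k).snd (V i k)ᶜ = 0 := by
        rw [Measure.snd_apply (hVm i k).compl]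
        refine measure_mono_null (fun z hz => ?_) (hσV i i' k)
        exact fun hz' => hz hz'.2
      have h4 : (A i' ×ˢ V i k)ᶜ ⊆ (A i')ᶜ ×ˢ Set.univ ∪ Set.univ ×ˢ (V i k)ᶜ := by
        intro z hz
        simp only [Set.mem_compl_iff, Set.mem_prod, not_and_or] at hz
        simpa using hz
      refine measure_mono_null h4 (measure_union_null ?_ ?_)
      · rw [Measure.prod_prod, hρA, zero_mul]
      · rw [Measure.prod_prod, h3, mul_zero]
    rw [hsumJ fun i i' k => ∫ z, ‖z.1 - z.2‖ ∂((ρ i').prod (σ i i' k).snd),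
      hsumJ fun i i' k => ∫ z, ‖z.1 - z.2‖ ∂(σ i i' k)] at hmain
    simp only [Finset.mul_sum] at hmain
    rw [← sub_nonpos] at hmain
    simp only [← Finset.sum_sub_distrib] at hmain
    rw [← sub_nonpos]
    simp only [← Finset.sum_sub_distrib]
    refine le_trans ?_ hmain
    refine Finset.sum_le_sum fun i _ => Finset.sum_le_sum fun i' _ =>
      Finset.sum_le_sum fun k _ => ?_
    have h1 := hsrc i i' k
    have h2 := hdst i i' k
    have h3 := hσm i i' k
    set m := (σ i i' k).real Set.univ with hm
    set a₁ := ∫ z, ‖z.1 - z.2‖ ∂(σ i i' k)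
    set a₂ := ∫ z, ‖z.1 - z.2‖ ∂((ρ i').prod (σ i i' k).snd)
    have hm0 : 0 ≤ m := measureReal_nonneg
    have hm1 : m ≤ c i i' k + ε := by linarith [(abs_le.1 h3).2]
    have h4 : m * g i i' k - 4 * ε * m ≤ s * a₂ - s * a₁ := by
      have e1 : |s * ((a₂ - m * ‖x i' - y i k‖) - (a₁ - m * ‖x i - y i k‖))| ≤ 4 * ε * m := by
        rw [abs_mul, hs, one_mul]
        refine (abs_sub _ _).trans ?_
        linarith
      have e2 := (abs_le.1 e1).1
      simp only [hg]
      linarith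
    have h5 : c i i' k * g i i' k - m * g i i' k ≤ ε * |g i i' k| := by
      rw [← sub_mul]
      refine (le_abs_self _).trans ?_
      rw [abs_mul, abs_sub_comm]
      gcongr
    have h6 : 4 * ε * m ≤ 4 * ε * (c i i' k + ε) := by gcongr
    linarith
  have hlim : Filter.Tendsto
      (fun ε : ℝ => ∑ i, ∑ i', ∑ k, (ε * |g i i' k| + 4 * ε * (c i i' k + ε)))
      (nhdsWithin 0 (Set.Ioi 0)) (nhds 0) := by
    have hcont : Continuous
        (fun ε : ℝ => ∑ i, ∑ i', ∑ k, (ε * |g i i' k| + 4 * ε * (c i i' k + ε))) := by fun_prop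
    have := (hcont.tendsto 0).mono_left (nhdsWithin_le_nhds (s := Set.Ioi 0))
    simpa using this
  exact ge_of_tendsto hlim (by filter_upwards [self_mem_nhdsWithin] using key)

/-- Finitely many fibres of an optimal plan admit approximate dual potentials. -/
theorem exists_approx_dual_finite {d : ℕ} {μ ν : Measure (Rd d)} [IsProbabilityMeasure μ]
    (hμ : Integrable (fun x : Rd d => x) μ) (hν : Integrable (fun x : Rd d => x) ν)
    {π : Measure (Rd d × Rd d)} (hπ : π ∈ MT μ ν) {s : ℝ} (hs : |s| = 1)
    (hopt : ∀ π' ∈ MT μ ν, s * transportCost π' ≤ s * transportCost π)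
    {κ : Kernel (Rd d) (Rd d)} (hκ : IsDisintegration π μ κ)
    {I : Type*} [Fintype I] (x : I → Rd d) (hx : ∀ i, IsGoodPoint μ κ (x i)) {q : Rd d}
    (hq : ∀ i, q ∈ interior (convexHull ℝ (κ (x i)).support))
    (Y : I → Finset (Rd d)) (hY : ∀ i, (Y i : Set (Rd d)) ⊆ (κ (x i)).support)
    {ε : ℝ} (hε : 0 < ε) :
    ∃ L : I → (ℝ × Rd d) →L[ℝ] ℝ, ∀ i i', ∀ y ∈ Y i,
      s * ‖x i' - y‖ - s * ‖x i - y‖ - ε ≤ L i (homogenize y) - L i' (homogenize y) := by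
  classical
  have hT : ∀ i, ∃ T : Finset (Rd d), Y i ⊆ T ∧ (T : Set (Rd d)) ⊆ (κ (x i)).support ∧
      Submodule.span ℝ (homogenize '' (T : Set (Rd d))) = ⊤ ∧
      ∃ c : Rd d → ℝ, (∀ y ∈ T, 0 < c y) ∧ ∑ y ∈ T, c y • homogenize y = homogenize q := by
    intro i
    obtain ⟨T₀, hT₀, hspan⟩ := exists_finset_span_homogenize ⟨q, hq i⟩
    obtain ⟨T, hT, hTS, c, hc, hcq⟩ := exists_pos_weights_of_mem_interior_convexHull (hq i)
      (Y i ∪ T₀) (by rw [Finset.coe_union]; exact Set.union_subset (hY i) hT₀)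
    refine ⟨T, Finset.subset_union_left.trans hT, hTS, ?_, c, hc, hcq⟩
    rw [eq_top_iff, ← hspan]
    exact Submodule.span_mono (Set.image_mono
      (by exact_mod_cast Finset.subset_union_right.trans hT))
  choose T hYT hTS hspan c hc hcq using hT
  have hspan' : ∀ i, Submodule.span ℝ (Set.range fun k : T i => homogenize (k : Rd d)) = ⊤ := by
    intro i
    rw [← hspan i]
    congr 1
    ext z
    simp
  let J := Σ i : I, I × T i
  have hsumJ : ∀ {F : Type} [AddCommMonoid F] (f : ∀ i, I → T i → F),
      ∑ j : J, f j.1 j.2.1 j.2.2 = ∑ i, ∑ i', ∑ k, f i i' k := by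
    intro F _ f
    rw [Fintype.sum_sigma]
    exact Finset.sum_congr rfl fun i _ => Fintype.sum_prod_type _
  set g : ∀ i, I → T i → ℝ := fun i i' k =>
    s * ‖x i' - k‖ - s * ‖x i - k‖ with hg
  -- A combination of these vectors vanishes exactly when every fibre loses and gains the same mass
  -- and moment.
  set v : J → (I → ℝ × Rd d) := fun j =>
    Pi.single j.1 (homogenize (j.2.2 : Rd d)) - Pi.single j.2.1 (homogenize (j.2.2 : Rd d)) with hv
  obtain ⟨f, hf⟩ := exists_functional_of_forall_nonneg_weights v
    (fun j : J => g j.1 j.2.1 j.2.2) (by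
      intro w hw hw0
      have hbal : ∀ i, ∑ i', ∑ k : T i, w ⟨i, i', k⟩ • homogenize (k : Rd d)
          = ∑ i', ∑ k : T i', w ⟨i', i, k⟩ • homogenize (k : Rd d) := by
        intro i
        have h1 := congrFun hw0 i
        rw [Finset.sum_apply] at h1
        have h2 := hsumJ fun a b k => (w ⟨a, b, k⟩ • v ⟨a, b, k⟩) i
        have h3 : ∑ a, ∑ b, ∑ k, (w ⟨a, b, k⟩ • v ⟨a, b, k⟩) i = 0 := h2.symm.trans h1
        simp only [hv, Pi.smul_apply, Pi.sub_apply, smul_sub, Finset.sum_sub_distrib,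
          Pi.single_apply, smul_ite, smul_zero] at h3
        rw [sub_eq_zero] at h3
        convert h3 using 1
        · simp [Finset.sum_ite_irrel]
        · simp [Finset.sum_ite_irrel]
      -- Finite optimality needs positive weights. Adding `τ * c i k` preserves the balance because
      -- every fibre represents the same point `q`; then `τ` tends to 0.
      have key : ∀ τ : ℝ, 0 < τ → ∑ i, ∑ i', ∑ k : T i,
          (w ⟨i, i', k⟩ + τ * c i k) * g i i' k ≤ 0 := by
        intro τ hτ
        refine sum_weights_cost_le_zero_of_pos hμ hν hπ hs hopt hκ (fun i => T i) x hx
          (fun i k => (k : Rd d)) (fun i k => hTS i k.2) hspan'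
          (fun i i' k => w ⟨i, i', k⟩ + τ * c i k) (fun i i' k => ?_) fun i => ?_
        · have := hw ⟨i, i', k⟩
          have := mul_pos hτ (hc i k k.2)
          linarith
        · have h4 : ∀ i, ∑ k : T i, (τ * c i k) • homogenize (k : Rd d) = τ • homogenize q := by
            intro i
            rw [← hcq i, Finset.smul_sum, ← Finset.sum_coe_sort (T i)]
            simp only [mul_smul]
          simp only [add_smul, Finset.sum_add_distrib, hbal i, h4]
      have hlim : Filter.Tendsto (fun τ : ℝ => ∑ i, ∑ i', ∑ k : T i,
          (w ⟨i, i', k⟩ + τ * c i k) * g i i' k) (nhdsWithin 0 (Set.Ioi 0))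
          (nhds (∑ i, ∑ i', ∑ k : T i, w ⟨i, i', k⟩ * g i i' k)) := by
        have hcont : Continuous (fun τ : ℝ => ∑ i, ∑ i', ∑ k : T i,
          (w ⟨i, i', k⟩ + τ * c i k) * g i i' k) := by fun_prop
        have := (hcont.tendsto 0).mono_left (nhdsWithin_le_nhds (s := Set.Ioi 0))
        simpa using this
      have h5 := le_of_tendsto hlim (by filter_upwards [self_mem_nhdsWithin] using key)
      rw [← hsumJ fun i i' k => w ⟨i, i', k⟩ * g i i' k] at h5
      exact h5) hε
  refine ⟨fun i => f.comp (ContinuousLinearMap.single ℝ (fun _ : I => ℝ × Rd d) i), ?_⟩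
  intro i i' y hy
  have h1 := hf ⟨i, i', y, hYT i hy⟩
  simp only [hv, hg, map_sub] at h1
  simpa using h1

/-! ### Potentials for all fibres by compactness -/

theorem exists_finset_subset_convexHull {d : ℕ} {S : Set (Rd d)} (P : Finset (Rd d))
    (hP : (P : Set (Rd d)) ⊆ convexHull ℝ S) :
    ∃ T : Finset (Rd d), (T : Set (Rd d)) ⊆ S ∧ (P : Set (Rd d)) ⊆ convexHull ℝ T := by
  classical
  have h : ∀ p : P, ∃ T : Finset (Rd d), (T : Set (Rd d)) ⊆ S ∧
      (p : Rd d) ∈ convexHull ℝ (T : Set (Rd d)) := by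
    intro p
    have := hP p.2
    rw [convexHull_eq_union_convexHull_finite_subsets] at this
    simpa using this
  choose T hTS hpT using h
  refine ⟨Finset.univ.biUnion T, ?_, fun p hp => ?_⟩
  · intro y hy
    simp only [Finset.coe_biUnion, Set.mem_iUnion] at hy
    obtain ⟨p, -, hy⟩ := hy
    exact hTS p hy
  · refine convexHull_mono ?_ (hpT ⟨p, hp⟩)
    exact_mod_cast Finset.subset_biUnion_of_mem T (Finset.mem_univ _)

/-- Evaluation at a spanning set is injective and linear on a finite-dimensional space, hence
antilipschitz. -/
theorem exists_norm_le_of_abs_apply_homogenize_le {d : ℕ} {P : Finset (Rd d)}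
    (hP : Submodule.span ℝ (homogenize '' (P : Set (Rd d))) = ⊤) :
    ∃ K : NNReal, ∀ (L : (ℝ × Rd d) →L[ℝ] ℝ) (C : ℝ), 0 ≤ C →
      (∀ p ∈ P, |L (homogenize p)| ≤ C) → ‖L‖ ≤ K * C := by
  let Φ : ((ℝ × Rd d) →L[ℝ] ℝ) →ₗ[ℝ] (P → ℝ) :=
    { toFun := fun L p => L (homogenize p)
      map_add' := fun _ _ => rfl
      map_smul' := fun _ _ => rfl }
  have hker : LinearMap.ker Φ = ⊥ := by
    rw [LinearMap.ker_eq_bot']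
    intro L hL
    have h1 : Submodule.span ℝ (homogenize '' (P : Set (Rd d))) ≤ LinearMap.ker L.toLinearMap := by
      rw [Submodule.span_le]
      rintro _ ⟨p, hp, rfl⟩
      exact congrFun hL ⟨p, hp⟩
    rw [hP] at h1
    ext z
    · exact h1 (Submodule.mem_top (x := ((1 : ℝ), (0 : Rd d))))
    · exact h1 Submodule.mem_top
  obtain ⟨K, -, hK⟩ := Φ.exists_antilipschitzWith hker
  refine ⟨K, fun L C hC hL => ?_⟩
  have h1 := hK.le_mul_dist L 0
  rw [map_zero, dist_zero_right, dist_zero_right] at h1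
  refine h1.trans (mul_le_mul_of_nonneg_left ?_ K.2)
  exact (pi_norm_le_iff_of_nonneg hC).2 fun p => hL p p.2

theorem isCompact_setOf_abs_apply_homogenize_le {d : ℕ} {P : Finset (Rd d)}
    (hP : Submodule.span ℝ (homogenize '' (P : Set (Rd d))) = ⊤) {C : ℝ} (hC : 0 ≤ C) :
    IsCompact {L : (ℝ × Rd d) →L[ℝ] ℝ | ∀ p ∈ P, |L (homogenize p)| ≤ C} := by
  obtain ⟨K, hK⟩ := exists_norm_le_of_abs_apply_homogenize_le hP
  refine Metric.isCompact_of_isClosed_isBounded ?_ ?_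
  · have h : {L : (ℝ × Rd d) →L[ℝ] ℝ | ∀ p ∈ P, |L (homogenize p)| ≤ C}
        = ⋂ p ∈ P, {L | |L (homogenize p)| ≤ C} := by ext; simp
    rw [h]
    exact isClosed_biInter fun p _ => isClosed_le (by fun_prop) continuous_const
  · refine (Metric.isBounded_closedBall (x := 0) (r := K * C)).subset fun L hL => ?_
    rw [mem_closedBall_zero_iff]
    exact hK L C hC hL

theorem abs_mul_norm_sub_mul_norm_le {d : ℕ} {s : ℝ} (hs : |s| = 1) (x x' y : Rd d) :
    |s * ‖x' - y‖ - s * ‖x - y‖| ≤ ‖x' - x‖ := by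
  rw [← mul_sub, abs_mul, hs, one_mul]
  refine (abs_norm_sub_norm_le _ _).trans (le_of_eq ?_)
  congr 1
  abel

/-- Dual potentials for the fibres over good points whose supports have a common point in the
interior of their convex hulls. -/
theorem exists_dual {d : ℕ} {μ ν : Measure (Rd d)} [IsProbabilityMeasure μ]
    (hμ : Integrable (fun x : Rd d => x) μ) (hν : Integrable (fun x : Rd d => x) ν)
    {π : Measure (Rd d × Rd d)} (hπ : π ∈ MT μ ν) {s : ℝ} (hs : |s| = 1)
    (hopt : ∀ π' ∈ MT μ ν, s * transportCost π' ≤ s * transportCost π)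
    {κ : Kernel (Rd d) (Rd d)} (hκ : IsDisintegration π μ κ)
    {X : Set (Rd d)} (hX : ∀ x ∈ X, IsGoodPoint μ κ x) {q : Rd d}
    (hq : ∀ x ∈ X, q ∈ interior (convexHull ℝ (κ x).support)) {P : Finset (Rd d)}
    (hP : Submodule.span ℝ (homogenize '' (P : Set (Rd d))) = ⊤)
    (hPX : ∀ x ∈ X, (P : Set (Rd d)) ⊆ convexHull ℝ (κ x).support) :
    ∃ L : Rd d → (ℝ × Rd d) →L[ℝ] ℝ, ∀ x ∈ X, ∀ x' ∈ X, ∀ y ∈ (κ x).support,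
      s * ‖x' - y‖ - s * ‖x - y‖ ≤ L x (homogenize y) - L x' (homogenize y) := by
  classical
  rcases X.eq_empty_or_nonempty with rfl | ⟨o, ho⟩
  · exact ⟨0, by simp⟩
  have hT : ∀ x : Rd d, ∃ T : Finset (Rd d), x ∈ X → (T : Set (Rd d)) ⊆ (κ x).support ∧
      (P : Set (Rd d)) ⊆ convexHull ℝ T := by
    intro x
    by_cases hx : x ∈ X
    · obtain ⟨T, h1, h2⟩ := exists_finset_subset_convexHull P (hPX x hx)
      exact ⟨T, fun _ => ⟨h1, h2⟩⟩
    · exact ⟨∅, fun h => absurd h hx⟩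
  choose T hT using hT
  let ι := {a : Rd d × Rd d × Rd d // a.1 ∈ X ∧ a.2.1 ∈ X ∧ a.2.2 ∈ (κ a.1).support} × ℕ
  -- Normalizing the potential at `o` to 0, the dual inequalities with `o` bound the others on `P`
  -- by `‖x - o‖` plus the slack, which is at most 1. By Tychonoff the product is compact.
  set 𝒦 : Set (Rd d → (ℝ × Rd d) →L[ℝ] ℝ) := Set.pi Set.univ fun x =>
    {L | ∀ p ∈ P, |L (homogenize p)| ≤ ‖x - o‖ + 1} with h𝒦
  have h𝒦c : IsCompact 𝒦 := isCompact_univ_pi fun x =>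
    isCompact_setOf_abs_apply_homogenize_le hP (by positivity)
  set Cn : ι → Set (Rd d → (ℝ × Rd d) →L[ℝ] ℝ) := fun a =>
    {L | s * ‖a.1.1.2.1 - a.1.1.2.2‖ - s * ‖a.1.1.1 - a.1.1.2.2‖ - ((a.2 : ℝ) + 1)⁻¹
      ≤ L a.1.1.1 (homogenize a.1.1.2.2) - L a.1.1.2.1 (homogenize a.1.1.2.2)} with hCn
  have hCcl : ∀ a, IsClosed (Cn a) := by
    intro a
    refine isClosed_le continuous_const (Continuous.sub ?_ ?_)
    · exact (continuous_apply a.1.1.1).clm_apply continuous_const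
    · exact (continuous_apply a.1.1.2.1).clm_apply continuous_const
  have hfin : ∀ u : Finset ι, (𝒦 ∩ ⋂ a ∈ u, Cn a).Nonempty := by
    intro u
    set X₀ : Finset (Rd d) := insert o (u.image (fun a => a.1.1.1) ∪ u.image fun a => a.1.1.2.1)
      with hX₀
    have hoX₀ : o ∈ X₀ := Finset.mem_insert_self _ _
    have hX₀1 : ∀ a ∈ u, a.1.1.1 ∈ X₀ := fun a ha => Finset.mem_insert_of_mem
      (Finset.mem_union_left _ (Finset.mem_image_of_mem (fun a : ι => a.1.1.1) ha))
    have hX₀2 : ∀ a ∈ u, a.1.1.2.1 ∈ X₀ := fun a ha => Finset.mem_insert_of_mem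
      (Finset.mem_union_right _ (Finset.mem_image_of_mem (fun a : ι => a.1.1.2.1) ha))
    have hX₀X : ∀ x ∈ X₀, x ∈ X := by
      intro x hx
      simp only [hX₀, Finset.mem_insert, Finset.mem_union, Finset.mem_image] at hx
      rcases hx with rfl | ⟨a, -, rfl⟩ | ⟨a, -, rfl⟩
      · exact ho
      · exact a.1.2.1
      · exact a.1.2.2.1
    set Y : X₀ → Finset (Rd d) := fun x =>
      T x ∪ (u.filter fun a => a.1.1.1 = (x : Rd d)).image fun a => a.1.1.2.2 with hY
    have hYS : ∀ x : X₀, (Y x : Set (Rd d)) ⊆ (κ x).support := by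
      intro x y hy
      simp only [hY, Finset.coe_union, Set.mem_union, Finset.mem_coe, Finset.mem_image,
        Finset.mem_filter] at hy
      rcases hy with hy | ⟨a, ⟨-, ha⟩, rfl⟩
      · exact (hT x (hX₀X x x.2)).1 hy
      · rw [← ha]
        exact a.1.2.2.2
    set N := u.sup fun a => a.2 with hN
    have hεpos : (0 : ℝ) < ((N : ℝ) + 1)⁻¹ := by positivity
    have hε1 : ((N : ℝ) + 1)⁻¹ ≤ 1 := inv_le_one_of_one_le₀ (by linarith [N.cast_nonneg (α := ℝ)])
    obtain ⟨L, hL⟩ := exists_approx_dual_finite hμ hν hπ hs hopt hκ (fun x : X₀ => (x : Rd d))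
      (fun x => hX x (hX₀X x x.2)) (fun x => hq x (hX₀X x x.2)) Y hYS hεpos
    set Lo := L ⟨o, hoX₀⟩ with hLo
    refine ⟨fun x => if h : x ∈ X₀ then L ⟨x, h⟩ - Lo else 0, ?_, ?_⟩
    · intro x _
      simp only [Set.mem_ofPred_eq]
      intro p hp
      split_ifs with h
      · rw [abs_le]
        constructor
        · refine le_apply_homogenize_of_mem_convexHull _ (fun y hy => ?_) p
            ((hT x (hX₀X x h)).2 hp)
          have h1 := hL ⟨x, h⟩ ⟨o, hoX₀⟩ y (Finset.mem_union_left _ hy)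
          have h2 := (abs_le.1 (abs_mul_norm_sub_mul_norm_le hs x o y)).1
          rw [norm_sub_rev o x] at h2
          simp only [FunLike.coe_sub, Pi.sub_apply]
          linarith
        -- The lower bound came from points of the fibre of `x`; the upper bound uses points of the
        -- fibre of `o`, whose hull also contains `P`.
        · have h0 : -(‖x - o‖ + 1) ≤ (Lo - L ⟨x, h⟩) (homogenize p) := by
            refine le_apply_homogenize_of_mem_convexHull _ (fun y hy => ?_) p
              ((hT o ho).2 hp)
            have h1 := hL ⟨o, hoX₀⟩ ⟨x, h⟩ y (Finset.mem_union_left _ hy)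
            have h2 := (abs_le.1 (abs_mul_norm_sub_mul_norm_le hs o x y)).1
            simp only [FunLike.coe_sub, Pi.sub_apply]
            linarith
          simp only [FunLike.coe_sub, Pi.sub_apply] at h0 ⊢
          linarith
      · simp only [zero_apply, abs_zero]
        positivity
    · simp only [Set.mem_iInter]
      intro a ha
      have h1 := hL ⟨a.1.1.1, hX₀1 a ha⟩ ⟨a.1.1.2.1, hX₀2 a ha⟩ a.1.1.2.2
        (Finset.mem_union_right _ (Finset.mem_image.2
          ⟨a, Finset.mem_filter.2 ⟨ha, rfl⟩, rfl⟩))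
      have h2 : ((N : ℝ) + 1)⁻¹ ≤ ((a.2 : ℝ) + 1)⁻¹ := by
        have : a.2 ≤ N := Finset.le_sup (f := fun a : ι => a.2) ha
        gcongr
      simp only [hCn, Set.mem_ofPred_eq, dif_pos (hX₀1 a ha), dif_pos (hX₀2 a ha),
        FunLike.coe_sub, Pi.sub_apply]
      linarith
  obtain ⟨L, -, hL⟩ := h𝒦c.inter_iInter_nonempty Cn hCcl hfin
  refine ⟨L, fun x hx x' hx' y hy => ?_⟩
  have h1 : ∀ n : ℕ, s * ‖x' - y‖ - s * ‖x - y‖ - ((n : ℝ) + 1)⁻¹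
      ≤ L x (homogenize y) - L x' (homogenize y) := fun n =>
    Set.mem_iInter.1 hL (⟨(x, x', y), hx, hx', hy⟩, n)
  have h2 := tendsto_one_div_add_atTop_nhds_zero_nat (𝕜 := ℝ)
  simp only [one_div] at h2
  have h3 := (tendsto_const_nhds (x := s * ‖x' - y‖ - s * ‖x - y‖)).sub h2
  rw [sub_zero] at h3
  exact le_of_tendsto h3 (Filter.Eventually.of_forall h1)

/-! ### Differentiating the potentials -/

/-- Dual potentials are Lipschitz. -/
theorem exists_lipschitzOnWith_of_dual {d : ℕ} {κ : Kernel (Rd d) (Rd d)} {s : ℝ} (hs : |s| = 1)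
    {X : Set (Rd d)} {P : Finset (Rd d)}
    (hP : Submodule.span ℝ (homogenize '' (P : Set (Rd d))) = ⊤)
    (hPX : ∀ x ∈ X, (P : Set (Rd d)) ⊆ convexHull ℝ (κ x).support)
    {L : Rd d → (ℝ × Rd d) →L[ℝ] ℝ} (hL : ∀ x ∈ X, ∀ x' ∈ X, ∀ y ∈ (κ x).support,
      s * ‖x' - y‖ - s * ‖x - y‖ ≤ L x (homogenize y) - L x' (homogenize y)) :
    ∃ C : NNReal, LipschitzOnWith C L X := by
  obtain ⟨K, hK⟩ := exists_norm_le_of_abs_apply_homogenize_le hP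
  -- The bound holds on the fibre of `x` and extends to its hull, as the difference is affine in
  -- `y`. Swapping `x` and `x'` gives the other sign, since `P` lies in both hulls.
  have hle : ∀ x ∈ X, ∀ x' ∈ X, ∀ p ∈ P, -‖x - x'‖ ≤ (L x - L x') (homogenize p) := by
    intro x hx x' hx' p hp
    refine le_apply_homogenize_of_mem_convexHull _ (fun y hy => ?_) p (hPX x hx hp)
    have h1 := hL x hx x' hx' y hy
    have h2 := (abs_le.1 (abs_mul_norm_sub_mul_norm_le hs x x' y)).1
    rw [norm_sub_rev] at h2
    simp only [FunLike.coe_sub, Pi.sub_apply]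
    linarith
  refine ⟨K, LipschitzOnWith.of_dist_le_mul fun x hx x' hx' => ?_⟩
  rw [dist_eq_norm, dist_eq_norm]
  refine hK _ _ (norm_nonneg _) fun p hp => abs_le.2 ⟨hle x hx x' hx' p hp, ?_⟩
  have := hle x' hx' x hx p hp
  rw [norm_sub_rev] at this
  simp only [FunLike.coe_sub, Pi.sub_apply] at this ⊢
  linarith

/-- The gradient condition at a maximum, expressed through an affine map giving the direction
from `x` to the points of `S`. -/
theorem exists_affine_direction_of_dual {d : ℕ} (hd : 1 ≤ d) {s : ℝ} (hs : |s| = 1)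
    {X S : Set (Rd d)} {x : Rd d} {L : Rd d → (ℝ × Rd d) →L[ℝ] ℝ}
    (hL : ∀ x' ∈ X, ∀ y ∈ S,
      s * ‖x' - y‖ - s * ‖x - y‖ ≤ L x (homogenize y) - L x' (homogenize y))
    (hdiff : DifferentiableWithinAt ℝ L X x)
    (hmax : ∀ (f : Rd d → ℝ) (f' : Rd d →L[ℝ] ℝ), HasFDerivWithinAt f f' X x →
      IsMaxOn f X x → f' = 0) :
    (∃ T : Rd d →ᵃ[ℝ] Rd d, ∀ y ∈ S, y ≠ x → ‖T y‖ = 1 ∧ y - x = ‖y - x‖ • T y) ∧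
      (s = 1 → x ∉ S) := by
  obtain ⟨L', hL'⟩ := hdiff
  have hev : ∀ y : Rd d, HasFDerivWithinAt (fun x' => L x' (homogenize y))
      (L'.flip (homogenize y)) X x := fun y => by
    have := hL'.clm_apply (hasFDerivWithinAt_const (homogenize y) x X)
    refine this.congr_fderiv ?_
    ext v
    simp
  constructor
  · have hss : s * s = 1 := by rw [← abs_mul_abs_self, hs, one_mul]
    let N : (ℝ × Rd d) →ₗ[ℝ] Rd d :=
      { toFun := fun z => s • (InnerProductSpace.toDual ℝ (Rd d)).symm (L'.flip z)
        map_add' := fun a b => by simp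
        map_smul' := fun a b => by simp [smul_comm s a] }
    have hN : ∀ z v, inner ℝ (N z) v = s * L' v z := fun z v => by
      simp [N, inner_smul_left]
    refine ⟨N.toAffineMap.comp ((AffineMap.const ℝ (Rd d) (1 : ℝ)).prod (AffineMap.id ℝ (Rd d))),
      fun y hy hyx => ?_⟩
    have hT : (N.toAffineMap.comp ((AffineMap.const ℝ (Rd d) (1 : ℝ)).prod
      (AffineMap.id ℝ (Rd d)))) y = N (homogenize y) := rfl
    rw [hT]
    have hne : x - y ≠ 0 := sub_ne_zero.2 (Ne.symm hyx)
    have hnorm : HasFDerivWithinAt (fun x' : Rd d => ‖x' - y‖)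
        (‖x - y‖⁻¹ • innerSL ℝ (x - y)) X x := by
      have hpos : 0 < ‖x - y‖ := norm_pos_iff.2 hne
      have h1 := ((hasStrictFDerivAt_norm_sq (x - y)).hasFDerivAt.sqrt (by positivity)).comp x
        ((hasFDerivAt_id x).sub_const y)
      simp only [Real.sqrt_sq (norm_nonneg _)] at h1
      refine HasFDerivAt.hasFDerivWithinAt ?_
      have h2 : HasFDerivAt (fun x' : Rd d => ‖x' - y‖) _ x := h1
      refine h2.congr_fderiv ?_
      ext v
      simp
      ring
    have h0 := hmax _ _ ((hnorm.const_mul s).add (hev y)) fun x' hx' => by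
      have := hL x' hx' y hy
      simp only [Set.mem_ofPred_eq, Pi.add_apply]
      linarith
    have hpos : 0 < ‖y - x‖ := norm_pos_iff.2 (sub_ne_zero.2 hyx)
    have hdir : N (homogenize y) = ‖y - x‖⁻¹ • (y - x) := by
      refine ext_inner_right ℝ fun v => ?_
      have h1 := congrArg (fun f => f v) h0
      simp only [FunLike.coe_add, FunLike.coe_smul, Pi.add_apply, Pi.smul_apply, smul_eq_mul,
        innerSL_apply_apply, ContinuousLinearMap.flip_apply, zero_apply] at h1
      rw [hN, inner_smul_left, ← neg_sub x y, norm_neg, inner_neg_left]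
      simp only [conj_trivial]
      linear_combination s * h1 - (‖x - y‖⁻¹ * inner ℝ (x - y) v) * hss
    rw [hdir]
    constructor
    · rw [norm_smul, norm_inv, norm_norm, inv_mul_cancel₀ hpos.ne']
    · rw [smul_smul, mul_inv_cancel₀ hpos.ne', one_smul]
  · rintro rfl hxS
    -- If `x ∈ S`, the term `‖x' - x‖` dominates every functional `⟪v, x' - x⟫` with `‖v‖ ≤ 1`, so
    -- Fermat's theorem would prescribe a different derivative of the potential for each `v`.
    have key : ∀ v : Rd d, ‖v‖ ≤ 1 → innerSL ℝ v + L'.flip (homogenize x) = 0 := by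
      intro v hv
      refine hmax _ _ ((innerSL ℝ v).hasFDerivWithinAt.add (hev x)) fun x' hx' => ?_
      have h1 := hL x' hx' x hxS
      have h2 : inner ℝ v (x' - x) ≤ ‖x' - x‖ :=
        (real_inner_le_norm _ _).trans (mul_le_of_le_one_left (norm_nonneg _) hv)
      rw [inner_sub_right] at h2
      simp only [sub_self, norm_zero, one_mul, sub_zero] at h1
      simp only [Set.mem_ofPred_eq, Pi.add_apply, innerSL_apply_apply]
      linarith
    set v : Rd d := EuclideanSpace.single ⟨0, hd⟩ 1 with hv
    have hv1 : ‖v‖ = 1 := by simp [hv]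
    have h1 := key v hv1.le
    have h2 := key 0 (by simp)
    rw [map_zero, zero_add] at h2
    rw [h2, add_zero] at h1
    have h3 := congrArg (fun f => f v) h1
    simp only [innerSL_apply_apply, real_inner_self_eq_norm_sq, hv1, zero_apply] at h3
    norm_num at h3

/-- For almost every `x` such that the support of the fibre over `x` has full-dimensional convex
hull, the direction from `x` to the points of this support is given by an affine map. -/
theorem ae_exists_affine_direction {d : ℕ} (hd : 1 ≤ d) {μ ν : Measure (Rd d)}
    [IsProbabilityMeasure μ] (hμ : Integrable (fun x : Rd d => x) μ)
    (hν : Integrable (fun x : Rd d => x) ν) (hac : μ ≪ volume)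
    {π : Measure (Rd d × Rd d)} (hπ : π ∈ MT μ ν) {s : ℝ} (hs : |s| = 1)
    (hopt : ∀ π' ∈ MT μ ν, s * transportCost π' ≤ s * transportCost π)
    {κ : Kernel (Rd d) (Rd d)} (hκ : IsDisintegration π μ κ) :
    ∀ᵐ x ∂μ, (interior (convexHull ℝ (κ x).support)).Nonempty →
      (∃ T : Rd d →ᵃ[ℝ] Rd d, ∀ y ∈ (κ x).support, y ≠ x →
        ‖T y‖ = 1 ∧ y - x = ‖y - x‖ • T y) ∧ (s = 1 → x ∉ (κ x).support) := by
  have hc : Countable (TopologicalSpace.countableBasis (Rd d)) :=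
    (TopologicalSpace.countable_countableBasis _).to_subtype
  have hbasis := TopologicalSpace.isBasis_countableBasis (Rd d)
  have hV : ∀ V : TopologicalSpace.countableBasis (Rd d), ∀ᵐ x ∂μ, IsGoodPoint μ κ x →
      (V : Set (Rd d)).Nonempty → (V : Set (Rd d)) ⊆ convexHull ℝ (κ x).support →
      (∃ T : Rd d →ᵃ[ℝ] Rd d, ∀ y ∈ (κ x).support, y ≠ x →
        ‖T y‖ = 1 ∧ y - x = ‖y - x‖ • T y) ∧ (s = 1 → x ∉ (κ x).support) := by
    rintro ⟨V, hV⟩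
    rcases V.eq_empty_or_nonempty with rfl | ⟨q, hq⟩
    · simp
    have hVo : IsOpen V := hbasis.isOpen hV
    obtain ⟨P, hPV, hP⟩ := exists_finset_span_homogenize (S := V)
      ⟨q, interior_maximal (subset_convexHull ℝ V) hVo hq⟩
    -- Measurability of this set is never established; both a.e. theorems used below hold for
    -- arbitrary sets.
    set X : Set (Rd d) := {x | IsGoodPoint μ κ x ∧ V ⊆ convexHull ℝ (κ x).support} with hX
    have hPX : ∀ x ∈ X, (P : Set (Rd d)) ⊆ convexHull ℝ (κ x).support := fun x hx =>
      hPV.trans hx.2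
    obtain ⟨L, hL⟩ := exists_dual hμ hν hπ hs hopt hκ (X := X) (fun x hx => hx.1)
      (fun x hx => interior_maximal hx.2 hVo hq) hP hPX
    obtain ⟨C, hC⟩ := exists_lipschitzOnWith_of_dual hs hP hPX hL
    have h1 : ∀ᵐ x ∂(volume : Measure (Rd d)), x ∈ X → DifferentiableWithinAt ℝ L X x :=
      hC.ae_differentiableWithinAt_of_mem
    filter_upwards [hac.ae_le h1,
      hac.ae_le (ae_fderivWithin_eq_zero_of_isMaxOn (volume : Measure (Rd d)) X)]
      with x h1 h2 hgood _ hVx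
    have hx : x ∈ X := ⟨hgood, hVx⟩
    exact exists_affine_direction_of_dual hd hs (fun x' hx' => hL x hx x' hx') (h1 hx) (h2 hx)
  filter_upwards [ae_all_iff.2 hV, ae_isGoodPoint μ κ] with x hx hgood hne
  obtain ⟨p, hp⟩ := hne
  obtain ⟨V, hVb, hpV, hVsub⟩ := hbasis.exists_subset_of_mem_open hp isOpen_interior
  exact hx ⟨V, hVb⟩ hgood ⟨p, hpV⟩ (hVsub.trans interior_subset)

/-! ### Conclusion -/

/-- A set carrying `ν` and null complement-wise has full `κ x`-measure for a.e. `x`; choosing it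
`μ`-null puts a.e. `x` in its `κ x`-null complement. -/
theorem ae_kernel_singleton_eq_zero {d : ℕ} {μ ν : Measure (Rd d)} [IsProbabilityMeasure μ]
    {π : Measure (Rd d × Rd d)} (hsnd : π.snd = ν) {κ : Kernel (Rd d) (Rd d)}
    (hκ : IsDisintegration π μ κ) (hsing : μ ⟂ₘ ν) : ∀ᵐ x ∂μ, κ x {x} = 0 := by
  obtain ⟨hκM, hdis⟩ := hκ
  obtain ⟨A, hA, hμA, hνA⟩ := hsing
  rw [← hsnd, Measure.snd_apply hA.compl, hdis,
    Measure.compProd_apply (measurable_snd hA.compl),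
    lintegral_eq_zero_iff (Kernel.measurable_kernel_prodMk_left (measurable_snd hA.compl))] at hνA
  have hμA' : ∀ᵐ x ∂μ, x ∉ A := by
    rw [ae_iff]
    simpa using hμA
  filter_upwards [hνA, hμA'] with x h1 h2
  exact measure_mono_null (Set.singleton_subset_iff.2 h2) h1

theorem corollary2p11 (d : ℕ) (hd : 1 ≤ d)
    (μ ν : Measure (Rd d)) [IsProbabilityMeasure μ] [IsProbabilityMeasure ν]
    (hμ1 : Integrable (fun x : Rd d => x) μ) (hν1 : Integrable (fun y : Rd d => y) ν)
    (hμ : μ ≪ volume)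
    (π : Measure (Rd d × Rd d))
    (hπ : IsMaximizer μ ν π ∨ (IsMinimizer μ ν π ∧ μ ⊓ ν = 0))
    (κ : Kernel (Rd d) (Rd d)) (hκ : IsDisintegration π μ κ) :
    ∀ᵐ x ∂μ,
      dimH (κ x).support ≤ ((d - 1 : ℕ) : ℝ≥0∞) ∧
      (Module.finrank ℝ (affineSpan ℝ (κ x).support).direction = d →
        (κ x).support = (convexHull ℝ (κ x).support).extremePoints ℝ) := by
  have hκM : IsMarkovKernel κ := hκ.1
  have hMT : π ∈ MT μ ν := by
    rcases hπ with h | h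
    · exact h.1
    · exact h.1.1
  have hdir : ∀ᵐ x ∂μ, (interior (convexHull ℝ (κ x).support)).Nonempty →
      (∃ T : Rd d →ᵃ[ℝ] Rd d, ∀ y ∈ (κ x).support, y ≠ x →
        ‖T y‖ = 1 ∧ y - x = ‖y - x‖ • T y) ∧ κ x {x} = 0 := by
    rcases hπ with h | ⟨h, hsing⟩
    · filter_upwards [ae_exists_affine_direction hd hμ1 hν1 hμ hMT (s := 1) (by simp)
        (fun π' hπ' => by simpa using h.2 hπ') hκ] with x hx hne
      obtain ⟨h1, h2⟩ := hx hne
      refine ⟨h1, measure_mono_null (Set.singleton_subset_iff.2 (h2 rfl))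
        Measure.measure_compl_support⟩
    · have hms : μ ⟂ₘ ν := Measure.mutuallySingular_of_disjoint (disjoint_iff.2 hsing)
      filter_upwards [ae_exists_affine_direction hd hμ1 hν1 hμ hMT (s := -1) (by simp)
        (fun π' hπ' => by simpa using h.2 hπ') hκ,
        ae_kernel_singleton_eq_zero hMT.2.1 hκ hms] with x hx h0 hne
      exact ⟨(hx hne).1, h0⟩
  have hbar : ∀ᵐ x ∂μ, HasBarycenter (κ x) x := by
    obtain ⟨-, -, κ', ⟨hκ'M, hdis'⟩, hb⟩ := hMT
    -- Membership in `MT` supplies its own kernel; a.e. uniqueness of disintegrations transfers the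
    -- barycentres to `κ`.
    have : κ' =ᵐ[μ] κ := Kernel.ae_eq_of_compProd_eq (hdis'.symm.trans hκ.2)
    filter_upwards [this, hb] with x h1 h2
    rwa [← h1]
  filter_upwards [hdir, hbar] with x hx hbx
  by_cases hfull : Module.finrank ℝ (affineSpan ℝ (κ x).support).direction = d
  · have hsne : (κ x).support.Nonempty := by
      have h : ∀ᵐ y ∂(κ x), y ∈ (κ x).support := Measure.support_mem_ae
      exact h.exists
    have hspan : affineSpan ℝ (κ x).support = ⊤ := by
      rw [← AffineSubspace.direction_eq_top_iff_of_nonempty (hsne.affineSpan ℝ)]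
      refine Submodule.eq_top_of_finrank_eq ?_
      rw [hfull, finrank_euclideanSpace_fin]
    have hne : (interior (convexHull ℝ (κ x).support)).Nonempty :=
      interior_convexHull_nonempty_iff_affineSpan_eq_top.2 hspan
    obtain ⟨⟨T, hT⟩, h0⟩ := hx hne
    obtain ⟨hTx, hxs⟩ := hbx.notMem_support_of_affine_direction h0 T hT
    have hsub : (κ x).support ⊆ (convexHull ℝ (κ x).support).extremePoints ℝ :=
      subset_extremePoints_of_affine_direction T hTx fun y hy =>
        hT y hy fun h => hxs (h ▸ hy)
    have heq := hsub.antisymm extremePoints_convexHull_subset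
    refine ⟨?_, fun _ => heq⟩
    -- In dimension 0 a point is both extreme and interior; `1 ≤ d` makes extreme points disjoint
    -- from the interior.
    have : Nonempty (Fin d) := ⟨⟨0, hd⟩⟩
    refine (convex_convexHull ℝ _).dimH_le_of_disjoint_interior hne (subset_convexHull ℝ _) ?_
    exact (disjoint_interior_extremePoints _).symm.mono_left hsub
  · refine ⟨(dimH_le_finrank_direction _).trans ?_, fun h => absurd h hfull⟩
    have h1 := Submodule.finrank_le (affineSpan ℝ (κ x).support).direction
    rw [finrank_euclideanSpace_fin] at h1
    exact_mod_cast (by omega : Module.finrank ℝ (affineSpan ℝ (κ x).support).direction ≤ d - 1)
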